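/- Let $p$ be an odd prime, let $d \ge 1$ be an integer, and let $\mathbb{Q}_p$ denote the field of $p$-adic numbers. Let $G$ be a maximal finite $p$-subgroup of $\mathrm{GL}_d(\mathbb{Q}_p)$, that is, a maximal element, with respect to inclusion, of the set of all finite $p$-subgroups of $\mathrm{GL}_d(\mathbb{Q}_p)$. Then $$\mathrm{rk}(G) = \left\lfloor \frac{d}{p-1} \right\rfloor .$$ Here $\mathrm{rk}(G) = \sup\{ d(H) \mid H \le G \}$, where $H$ ranges over all closed subgroups of $G$ and $d(H)$ denotes the minimal cardinality of a topological generating set of $H$; as the finite group $G$ is discrete, $H$ ranges over all subgroups of $G$, and $d(H)$ is the minimal number of generators of $H$. -/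

import Mathlib

/-- The minimal cardinality `d(G)` of a topological generating set of the topological group `G`
(`⊤` if no finite set generates a dense subgroup). -/
noncomputable def topGenNumber (G : Type*) [Group G] [TopologicalSpace G] : ℕ∞ :=
  ⨅ (S : Set G) (_ : Dense (Subgroup.closure S : Set G)), S.encard

/-- The rank `rk(G) = sup {d(H) | H ≤ G}`, where `H` ranges over the closed subgroups of the
topological group `G`. A finite Hausdorff group is discrete; then `H` ranges over all subgroups
and `d(H)` is the minimal number of generators of `H`. -/
noncomputable def profiniteRank (G : Type*) [Group G] [TopologicalSpace G] : ℕ∞ :=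
  ⨆ (H : Subgroup G) (_ : IsClosed (H : Set G)), topGenNumber H

/-- `G` is a maximal finite `p`-subgroup of `Γ`: a maximal element, with respect to inclusion,
of the set of all finite `p`-subgroups of `Γ`. -/
def IsMaximalFinitePSubgroup (p : ℕ) {Γ : Type*} [Group Γ] (G : Subgroup Γ) : Prop :=
  Maximal (fun H : Subgroup Γ => Finite H ∧ IsPGroup p H) G

/-! Both bounds come from one structural fact: over a field of characteristic zero in which every
`cyclotomic (p ^ (n + 1))` is irreducible, a finite `p`-group of automorphisms of V is, up to a
small trivial part, monomial over the `p`-th roots of unity. For `ℚ_[p]` the irreducibility is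
Eisenstein's criterion.

Given a finite `p`-group H in GL(V), choose s with s ^ p = 1 commuting with H and having a fixed
space of least dimension. Minimality forces H to fix that space pointwise and its dimension to be
below p - 1 (`exists_commuting_automorphism`). On the complement U, where 1 + s + ⋯ + s ^ (p - 1)
vanishes, `exists_monomialFrame` finds a finite set R of vectors that H permutes up to powers of s,
whose s-translates span U, with (p - 1)|R| ≤ dim U. The proof is by induction on dim U: if the group
acts through a cyclic quotient, the orbit of one vector under a generator suffices; otherwise a
noncentral normal piece of rank two (this needs p odd) splits off eigenspaces and a frame is induced
from a centralizer. Maschke's theorem supplies the rest.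

Upper bound: every subgroup H of G acts faithfully on the at most p|R| vectors s ^ k v. A `p`-group
of permutations of n points has at most n / p independent homomorphisms to ℤ/p
(`IsPGroup.mul_homRank_le_card`), so by Burnside's basis theorem H is generated by at most |R| ≤ d /
(p - 1) elements.

Lower bound: apply the construction to G itself. The automorphisms acting on each s-orbit of the
frame as a power of s form an elementary abelian group of order at least p ^ |R| normalized by G, so
maximality puts it, like s, inside G. Since dim U = (p - 1)|R| and the fixed space has dimension
below p - 1, |R| is the integer part of d / (p - 1). -/

/-! ### Finite `p`-groups: cyclicity and normal subgroups of rank two -/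

theorem exists_pow_eq_zpow {p : ℕ} [hp : Fact p.Prime] {G : Type*} [Group G]
    {s : G} (hs : s ^ p = 1) (k : ℤ) :
    ∃ i < p, s ^ k = s ^ i := by
  have hpos : (0 : ℤ) < p := by exact_mod_cast hp.1.pos
  refine ⟨(k % p).toNat, ?_, ?_⟩
  · have := Int.emod_lt_of_pos k hpos
    have := Int.emod_nonneg k hpos.ne'
    omega
  · rw [← zpow_natCast s, Int.toNat_of_nonneg (Int.emod_nonneg k hpos.ne')]
    conv_lhs => rw [← Int.emod_add_mul_ediv k p, zpow_add, zpow_mul, zpow_natCast, hs, one_zpow,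
      mul_one]

/-- In class two, powers of a product are computed by the binomial formula. -/
theorem mul_pow_of_commute_commutator {G : Type*} [Group G] {a b c : G} (h : b * a = a * b * c)
    (hca : Commute c a) (hcb : Commute c b) (n : ℕ) :
    (a * b) ^ n = a ^ n * b ^ n * c ^ n.choose 2 := by
  have key : ∀ n : ℕ, b ^ n * a = a * b ^ n * c ^ n := by
    intro n
    induction n with
    | zero => simp
    | succ n ih =>
      calc b ^ (n + 1) * a = b ^ n * (b * a) := by rw [pow_succ, mul_assoc]
        _ = b ^ n * a * (b * c) := by rw [h]; simp only [mul_assoc]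
        _ = a * b ^ n * (c ^ n * b) * c := by rw [ih]; simp only [mul_assoc]
        _ = a * b ^ (n + 1) * c ^ (n + 1) := by
          rw [(hcb.pow_left n).eq, pow_succ b, pow_succ c]; simp only [mul_assoc]
  induction n with
  | zero => simp
  | succ n ih =>
    have hc : Nat.choose (n + 1) 2 = n + n.choose 2 := by
      rw [Nat.choose_succ_succ' n 1, Nat.choose_one_right]
    calc (a * b) ^ (n + 1) = a ^ n * b ^ n * (c ^ n.choose 2 * (a * b)) := by
          rw [pow_succ, ih, mul_assoc]
      _ = a ^ n * (b ^ n * a) * (b * c ^ n.choose 2) := by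
          rw [((hca.mul_right hcb).pow_left _).eq]; simp only [mul_assoc]
      _ = a ^ (n + 1) * b ^ n * (c ^ n * b) * c ^ n.choose 2 := by
          rw [key, pow_succ a]; simp only [mul_assoc]
      _ = a ^ (n + 1) * b ^ (n + 1) * c ^ (n + 1).choose 2 := by
          rw [(hcb.pow_left n).eq, hc, pow_add c, pow_succ b]; simp only [mul_assoc]

/-- For odd p the prime p divides the binomial coefficient p.choose 2, so the commutator term
disappears. This is where oddness of p enters the argument. -/
theorem mul_pow_prime_of_commute_commutator {G : Type*} [Group G] {p : ℕ} (hp : p.Prime)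
    (hodd : p ≠ 2) {a b c : G} (h : b * a = a * b * c) (hca : Commute c a) (hcb : Commute c b)
    (hc : c ^ p = 1) : (a * b) ^ p = a ^ p * b ^ p := by
  rw [mul_pow_of_commute_commutator h hca hcb]
  obtain ⟨k, hk⟩ := hp.dvd_choose_self (k := 2) two_ne_zero
    (lt_of_le_of_ne hp.two_le hodd.symm)
  rw [hk, pow_mul, hc, one_pow, mul_one]

theorem mem_zpowers_of_mem_zpowers_of_pow_prime_eq_one {G : Type*} [Group G] {p : ℕ}
    [hp : Fact p.Prime] {x z : G} (hz : z ^ p = 1) (hx : x ∈ Subgroup.zpowers z) (hx1 : x ≠ 1) :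
    z ∈ Subgroup.zpowers x := by
  have hz1 : z ≠ 1 := by
    rintro rfl
    simp at hx
    exact hx1 hx
  have hoz : orderOf z = p := orderOf_eq_prime hz hz1
  have hc : Nat.card (Subgroup.zpowers z) = p := by rw [Nat.card_zpowers, hoz]
  have hle : Subgroup.zpowers x ≤ Subgroup.zpowers z := by simpa using hx
  have hox : orderOf x = p := by
    refine orderOf_eq_prime ?_ hx1
    obtain ⟨k, rfl⟩ := hx
    simp only
    rw [← zpow_natCast, ← zpow_mul, mul_comm, zpow_mul, zpow_natCast, hz, one_zpow]
  have : Finite (Subgroup.zpowers z) := Nat.finite_of_card_ne_zero (by rw [hc]; exact hp.1.ne_zero)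
  have : Subgroup.zpowers x = Subgroup.zpowers z :=
    Subgroup.eq_of_le_of_card_ge hle (by rw [hc, Nat.card_zpowers, hox])
  rw [this]; exact Subgroup.mem_zpowers z

/-- A finite abelian `p`-group with a unique subgroup of order `p` is cyclic. -/
theorem IsPGroup.isCyclic_of_pow_prime_eq_one_imp {G : Type*} [CommGroup G] [Finite G] {p : ℕ}
    [hp : Fact p.Prime] (hG : IsPGroup p G) {z : G} (hz : z ^ p = 1)
    (h : ∀ e : G, e ^ p = 1 → e ∈ Subgroup.zpowers z) : IsCyclic G := by
  obtain ⟨g, hg⟩ := Monoid.exists_orderOf_eq_exponent (G := G) Monoid.ExponentExists.of_finite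
  obtain ⟨N, hN⟩ := (IsPGroup.iff_orderOf.mp hG) g
  have hpos := hp.1.pos
  have hexp : ∀ x : G, x ^ p ^ N = 1 := fun x => by
    rw [← hN, hg]; exact Monoid.pow_exponent_eq_one x
  rcases N with _ | N
  · have : Subsingleton G := ⟨fun a b => by
      have ha := hexp a
      have hb := hexp b
      rw [pow_zero, pow_one] at ha hb
      rw [ha, hb]⟩
    infer_instance
  have hzg : z ∈ Subgroup.zpowers g := by
    have h1 : g ^ p ^ N ≠ 1 := by
      intro h1
      have := orderOf_dvd_of_pow_eq_one h1
      rw [hN] at this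
      have := (Nat.pow_dvd_pow_iff_le_right hp.1.one_lt).mp this
      omega
    have h2 : g ^ p ^ N ∈ Subgroup.zpowers z := h _ (by rw [← pow_mul, ← pow_succ]; exact hexp g)
    have h3 := mem_zpowers_of_mem_zpowers_of_pow_prime_eq_one hz h2 h1
    exact (Subgroup.zpowers_le.mpr (Subgroup.npow_mem_zpowers g _)) h3
  have key : ∀ k : ℕ, ∀ x : G, x ^ p ^ k = 1 → x ∈ Subgroup.zpowers g := by
    intro k
    induction k with
    | zero => intro x hx; simp at hx; rw [hx]; exact Subgroup.one_mem _
    | succ k ih =>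
      intro x hx
      obtain ⟨m, hm⟩ := ih (x ^ p) (by rw [← pow_mul, ← pow_succ']; exact hx)
      simp only at hm
      -- The order of `g` is the exponent p ^ (N + 1), and g ^ (m * p ^ N) = x ^ p ^ (N + 1) = 1.
      -- Hence `x` can be corrected by a power of `g` to an element killed by p, which lies in ⟨z⟩ ≤
      -- ⟨g⟩.
      have hpm : (p : ℤ) ∣ m := by
        have h1 : g ^ (m * (p ^ N : ℕ)) = 1 := by
          rw [zpow_mul, hm, zpow_natCast, ← pow_mul, ← pow_succ']; exact hexp x
        rw [← orderOf_dvd_iff_zpow_eq_one, hN, pow_succ', Nat.cast_mul] at h1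
        have h0 : ((p ^ N : ℕ) : ℤ) ≠ 0 := by exact_mod_cast (pow_pos hpos N).ne'
        exact (mul_dvd_mul_iff_right h0).mp h1
      obtain ⟨m', rfl⟩ := hpm
      have h2 : (x * (g ^ m')⁻¹) ^ p = 1 := by
        rw [mul_pow, ← hm, inv_pow, ← zpow_natCast, ← zpow_mul, mul_comm m', mul_inv_cancel]
      have h3 : x * (g ^ m')⁻¹ ∈ Subgroup.zpowers g := Subgroup.zpowers_le.mpr hzg (h _ h2)
      have := Subgroup.mul_mem _ h3 (Subgroup.zpow_mem_zpowers g m')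
      rwa [inv_mul_cancel_right] at this
  rw [isCyclic_iff_exists_zpowers_eq_top]
  refine ⟨g, eq_top_iff.mpr fun x _ => key (N + 1) x (hexp x)⟩

theorem IsPGroup.exists_mem_center_pow_prime_eq_one {G : Type*} [Group G] [Finite G] [Nontrivial G]
    {p : ℕ} [hp : Fact p.Prime] (hG : IsPGroup p G) :
    ∃ z ∈ Subgroup.center G, z ^ p = 1 ∧ z ≠ 1 := by
  have := hG.center_nontrivial
  have hc := (hG.to_subgroup (Subgroup.center G))
  have hdvd : p ∣ Nat.card (Subgroup.center G) :=
    hc.card_eq_or_dvd.resolve_left (Finite.one_lt_card).ne'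
  obtain ⟨z, hz⟩ := exists_prime_orderOf_dvd_card' p hdvd
  refine ⟨z, z.2, ?_, ?_⟩
  · have := pow_orderOf_eq_one z
    rw [hz] at this
    exact_mod_cast congrArg Subtype.val this
  · intro h
    have : z = 1 := Subtype.ext h
    rw [this, orderOf_one] at hz
    exact hp.1.one_lt.ne hz

/-- A noncyclic finite `p`-group with `p` odd has, for each central `z` of order `p`, a normal
elementary abelian subgroup of rank two containing `z`. -/
theorem IsPGroup.exists_pow_prime_eq_one_and_commutator_mem_zpowers {p : ℕ} [hp : Fact p.Prime]
    (hodd : p ≠ 2) {G : Type*} [Group G] [Finite G] (hG : IsPGroup p G) (hcyc : ¬ IsCyclic G)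
    {z : G} (hzc : z ∈ Subgroup.center G) (hz : z ^ p = 1) (hz1 : z ≠ 1) :
    ∃ e : G, e ^ p = 1 ∧ e ∉ Subgroup.zpowers z ∧
      ∀ g : G, ∃ k : ℤ, g * e * g⁻¹ = e * z ^ k := by
  induction hn : Nat.card G using Nat.strong_induction_on generalizing G with
  | _ n ih =>
  have hcomm : ∀ g, Commute z g := fun g => (Subgroup.mem_center_iff.mp hzc g).symm
  have hnorm : (Subgroup.zpowers z).Normal := by
    refine ⟨fun x hx g => ?_⟩
    obtain ⟨k, rfl⟩ := hx
    refine ⟨k, ?_⟩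
    simp only
    rw [← ((hcomm g).zpow_left k).eq, mul_inv_cancel_right]
  -- A cyclic quotient by a central subgroup makes G abelian; conjugation is then trivial, and some
  -- e of order p lies outside ⟨z⟩ because G is not cyclic. Otherwise induction applies to the
  -- quotient, with a central y of order p there in the role of z.
  by_cases hq : IsCyclic (G ⧸ Subgroup.zpowers z)
  · have hab : IsMulCommutative G :=
      MonoidHom.isMulCommutative_of_isCyclic_of_ker_le_center (QuotientGroup.mk' (Subgroup.zpowers z))
        (by rw [QuotientGroup.ker_mk']; simpa using hzc)
    have hab' : ∀ a b : G, a * b = b * a := fun a b => hab.is_comm.comm a b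
    let _ : CommGroup G := { ‹Group G› with mul_comm := hab' }
    by_contra! hcon
    refine hcyc (hG.isCyclic_of_pow_prime_eq_one_imp hz fun e he => ?_)
    by_contra hez
    obtain ⟨g, hg⟩ := hcon e he hez
    exact hg 0 (by rw [hab' g e, mul_inv_cancel_right, zpow_zero, mul_one])
  · have hnt : Nontrivial (G ⧸ Subgroup.zpowers z) := by
      by_contra hnt
      rw [not_nontrivial_iff_subsingleton] at hnt
      exact hq inferInstance
    obtain ⟨y, hyc, hy, hy1⟩ := (hG.to_quotient (Subgroup.zpowers z)).exists_mem_center_pow_prime_eq_one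
    have hlt : Nat.card (G ⧸ Subgroup.zpowers z) < n := by
      have h1 := Subgroup.card_eq_card_quotient_mul_card_subgroup (Subgroup.zpowers z)
      rw [Nat.card_zpowers, orderOf_eq_prime hz hz1, hn] at h1
      have h2 : 0 < Nat.card (G ⧸ Subgroup.zpowers z) := Nat.card_pos
      rw [h1]
      exact lt_mul_of_one_lt_right h2 hp.1.one_lt
    obtain ⟨e, he, hey, hce⟩ := ih _ hlt (hG.to_quotient (Subgroup.zpowers z)) hq hyc hy hy1 rfl
    obtain ⟨y, rfl⟩ := QuotientGroup.mk_surjective y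
    obtain ⟨e, rfl⟩ := QuotientGroup.mk_surjective e
    have lift : ∀ a b : G, (a : G ⧸ Subgroup.zpowers z) = b → ∃ k : ℤ, a = b * z ^ k := by
      intro a b hab
      obtain ⟨k, hk⟩ := QuotientGroup.eq.mp hab.symm
      exact ⟨k, by simp only at hk; rw [hk, mul_inv_cancel_left]⟩
    have hyz : y ∉ Subgroup.zpowers z := fun h => hy1 ((QuotientGroup.eq_one_iff y).mpr h)
    have hyg : ∀ g, ∃ k : ℤ, g * y * g⁻¹ = y * z ^ k := fun g => lift _ _ (by
      rw [QuotientGroup.mk_mul, QuotientGroup.mk_mul, QuotientGroup.mk_inv,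
        Subgroup.mem_center_iff.mp hyc, mul_inv_cancel_right])
    -- If the lift of y has order p, it is the required element. Otherwise y ^ p generates ⟨z⟩, and
    -- powers of y can be used to correct the lift of e.
    by_cases hyp : y ^ p = 1
    · exact ⟨y, hyp, hyz, hyg⟩
    obtain ⟨k, hk⟩ := lift (y ^ p) 1 (by rw [QuotientGroup.mk_pow]; exact hy)
    rw [one_mul] at hk
    have hzy : z ∈ Subgroup.zpowers (y ^ p) :=
      mem_zpowers_of_mem_zpowers_of_pow_prime_eq_one hz ⟨k, hk.symm⟩ hyp
    obtain ⟨l, hl⟩ := lift (e ^ p) 1 (by rw [QuotientGroup.mk_pow]; exact he)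
    obtain ⟨m, hm⟩ := hzy
    simp only at hm
    have hpow : ∀ (x : G) (k j : ℤ), x * y * x⁻¹ = y * z ^ k →
        (x * y ^ j) ^ p = x ^ p * (y ^ j) ^ p := by
      intro x k j hx
      have hx2 : x * y ^ j * x⁻¹ = y ^ j * (z ^ k) ^ j := by
        rw [← conj_zpow, hx, ((hcomm y).zpow_left k).symm.mul_zpow]
      refine mul_pow_prime_of_commute_commutator hp.1 hodd (c := ((z ^ k) ^ j)⁻¹) ?_
        (((hcomm _).zpow_left _).zpow_left _).inv_left (((hcomm _).zpow_left _).zpow_left _).inv_left ?_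
      · rw [eq_mul_inv_iff_mul_eq, mul_inv_eq_iff_eq_mul.mp hx2, mul_assoc, mul_assoc,
          (((hcomm x).zpow_left _).zpow_left _).eq]
      · rw [inv_pow, ← zpow_mul, ← zpow_natCast, ← zpow_mul, mul_comm, zpow_mul, zpow_natCast, hz,
          one_zpow, inv_one]
    have hmod : ∀ j : ℤ, ((y ^ j : G) : G ⧸ Subgroup.zpowers z) ∈ Subgroup.zpowers (y : G ⧸ Subgroup.zpowers z) :=
      fun j => ⟨j, (QuotientGroup.mk_zpow _ _ _).symm⟩
    obtain ⟨ke, hke⟩ := hyg e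
    -- Here e ^ p = z ^ l and z = (y ^ p) ^ m, so the factor y ^ (-(m * l)) cancels the p-th power
    -- of e.
    have hep : (e * y ^ (-(m * l))) ^ p = 1 := by
      rw [hpow e ke _ hke, hl, one_mul, ← zpow_natCast, ← zpow_mul, mul_comm, zpow_mul, zpow_natCast,
        zpow_neg, zpow_mul, hm, mul_inv_cancel]
    have hnot : e * y ^ (-(m * l)) ∉ Subgroup.zpowers z := by
      intro h
      refine hey ?_
      have h1 := (QuotientGroup.eq_one_iff _).mpr h
      rw [QuotientGroup.mk_mul] at h1
      rw [eq_inv_of_mul_eq_one_left h1]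
      exact Subgroup.inv_mem _ (hmod _)
    refine ⟨e * y ^ (-(m * l)), hep, hnot, fun g => ?_⟩
    set f := e * y ^ (-(m * l)) with hf
    obtain ⟨a, ha⟩ := hce g
    obtain ⟨kf, hkf⟩ := hyg f
    obtain ⟨b, hb⟩ := hyg g
    have h1 : ∃ j : ℤ, g * f * g⁻¹ = f * y ^ a * z ^ j := by
      refine lift _ _ ?_
      have hcy : ∀ x : G ⧸ Subgroup.zpowers z, Commute x y := fun x => Subgroup.mem_center_iff.mp hyc x
      rw [hf]
      simp only [QuotientGroup.mk_mul, QuotientGroup.mk_inv, QuotientGroup.mk_zpow]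
      rw [mul_assoc, mul_assoc, ((hcy _).zpow_right _).symm.eq, ← mul_assoc, ← mul_assoc, ha,
        mul_assoc, mul_assoc, ((Commute.refl _).zpow_zpow a _).eq]
    obtain ⟨j, hj⟩ := h1
    have h2 : (g * f * g⁻¹) ^ p = 1 := by rw [conj_pow, hep, mul_one, mul_inv_cancel]
    -- The conjugate f * y ^ a * z ^ j again has order dividing p, as do f and z. Since y has order
    -- p ^ 2, this forces p ∣ a, so y ^ a is a power of z.
    have h3 : (y ^ a) ^ p = 1 := by
      rw [hj, ((hcomm _).zpow_left _).symm.mul_pow, hpow f kf a hkf, hep, one_mul, ← zpow_natCast (z ^ j),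
        ← zpow_mul, mul_comm j, zpow_mul, zpow_natCast, hz, one_zpow, mul_one] at h2
      exact h2
    have hoy : orderOf y = p ^ 2 := by
      refine orderOf_eq_prime_pow (by rwa [pow_one]) ?_
      rw [pow_add, pow_one, pow_mul, hk, ← zpow_natCast, ← zpow_mul, mul_comm, zpow_mul,
        zpow_natCast, hz, one_zpow]
    have h4 : (p : ℤ) ∣ a := by
      rw [← zpow_natCast, ← zpow_mul, ← orderOf_dvd_iff_zpow_eq_one, hoy, pow_two,
        Nat.cast_mul] at h3
      exact (mul_dvd_mul_iff_right (by exact_mod_cast hp.1.ne_zero)).mp h3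
    obtain ⟨a', rfl⟩ := h4
    refine ⟨k * a' + j, ?_⟩
    rw [hj, zpow_mul, zpow_natCast, hk, mul_assoc, ← zpow_mul, ← zpow_add]

/-! ### Homomorphisms to ℤ/p and Burnside's basis theorem -/

/-- The dimension of the `𝔽_p`-vector space of homomorphisms from `G` to `ℤ/p`. -/
noncomputable def homRank (p : ℕ) [Fact p.Prime] (G : Type*) [Group G] : ℕ :=
  Module.finrank (ZMod p) (Additive G →+ ZMod p)

section HomRank

variable {p : ℕ} [hp : Fact p.Prime]

instance finite_additive_hom_zmod (G : Type*) [Group G] [Finite G] :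
    Finite (Additive G →+ ZMod p) := DFunLike.finite _

/-- A proper subgroup of a finite `p`-group is killed by a nonzero homomorphism to `ℤ/p`. -/
theorem IsPGroup.exists_hom_zmod_ne_zero {G : Type*} [Group G] [Finite G] (hG : IsPGroup p G)
    {L : Subgroup G} (hL : L ≠ ⊤) :
    ∃ φ : Additive G →+ ZMod p, φ ≠ 0 ∧ ∀ g ∈ L, φ (Additive.ofMul g) = 0 := by
  obtain ⟨M, hM, hLM⟩ := (eq_top_or_exists_le_coatom L).resolve_left hL
  have hnil : Group.IsNilpotent G := hG.isNilpotent
  have hMn : M.Normal := by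
    have h := (Group.isNilpotent_of_finite_tfae (G := G)).out 0 2
    exact h.mp hnil M hM
  have hnt : Nontrivial (G ⧸ M) := QuotientGroup.nontrivial_iff.mpr hM.1
  obtain ⟨z, hzc, hz, hz1⟩ := (hG.to_quotient M).exists_mem_center_pow_prime_eq_one
  -- By maximality of M the quotient has no proper nontrivial subgroup, so it has order p.
  have htop : Subgroup.zpowers z = ⊤ := by
    have h1 : M < (Subgroup.zpowers z).comap (QuotientGroup.mk' M) := by
      refine lt_of_le_of_ne ?_ ?_
      · intro x hx
        rw [Subgroup.mem_comap, QuotientGroup.mk'_apply, (QuotientGroup.eq_one_iff x).mpr hx]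
        exact Subgroup.one_mem _
      · intro heq
        obtain ⟨y, rfl⟩ := QuotientGroup.mk_surjective z
        apply hz1
        rw [QuotientGroup.eq_one_iff, heq, Subgroup.mem_comap]
        exact Subgroup.mem_zpowers _
    have h2 := hM.2 _ h1
    rw [eq_top_iff]
    intro x _
    obtain ⟨y, rfl⟩ := QuotientGroup.mk_surjective x
    have : y ∈ (Subgroup.zpowers z).comap (QuotientGroup.mk' M) := by rw [h2]; trivial
    exact this
  have hcard : Nat.card (G ⧸ M) = p := by
    rw [← Subgroup.card_top (G := G ⧸ M), ← htop, Nat.card_zpowers, orderOf_eq_prime hz hz1]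
  have e : G ⧸ M ≃* Multiplicative (ZMod p) :=
    mulEquivOfPrimeCardEq (p := p) hcard (by simp)
  refine ⟨MonoidHom.toAdditiveLeft (e.toMonoidHom.comp (QuotientGroup.mk' M)), ?_, ?_⟩
  · intro h0
    obtain ⟨y, hy⟩ := QuotientGroup.mk_surjective z
    have h3 := DFunLike.congr_fun h0 (Additive.ofMul y)
    have h4 : e (y : G ⧸ M) = 1 := h3
    rw [hy, map_eq_one_iff e e.injective] at h4
    exact hz1 h4
  · intro g hg
    have : e (g : G ⧸ M) = 1 := by
      rw [(QuotientGroup.eq_one_iff g).mpr (hLM hg), map_one]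
    exact this

/-- Burnside's basis theorem: a finite `p`-group is generated by `homRank p G` elements. -/
theorem IsPGroup.exists_finset_closure_eq_top {G : Type*} [Group G] [Finite G] (hG : IsPGroup p G) :
    ∃ S : Finset G, Subgroup.closure (S : Set G) = ⊤ ∧ S.card ≤ homRank p G := by
  classical
  have : Fintype G := Fintype.ofFinite G
  obtain ⟨S, hS, hmin⟩ := WellFounded.has_min (measure (Finset.card (α := G))).wf
    {S : Finset G | Subgroup.closure (S : Set G) = ⊤}
    ⟨Finset.univ, by simp⟩
  refine ⟨S, hS, ?_⟩
  -- A generating set of least size loses generation when s is removed. A nonzero homomorphism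
  -- killing the remaining generators cannot kill s, and the homomorphisms obtained in this way are
  -- independent.
  have hex : ∀ s : S, ∃ φ : Additive G →+ ZMod p, φ (Additive.ofMul s.1) ≠ 0 ∧
      ∀ t : S, t ≠ s → φ (Additive.ofMul t.1) = 0 := by
    intro s
    have hne : Subgroup.closure ((S.erase s.1 : Finset G) : Set G) ≠ ⊤ := fun h =>
      hmin _ h (Finset.card_erase_lt_of_mem s.2)
    obtain ⟨φ, hφ, hφ0⟩ := hG.exists_hom_zmod_ne_zero hne
    have ht : ∀ t : S, t ≠ s → φ (Additive.ofMul t.1) = 0 := fun t hts =>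
      hφ0 _ (Subgroup.subset_closure
        (by simpa using fun h => hts (Subtype.ext h)))
    refine ⟨φ, fun hs => hφ ?_, ht⟩
    have hle : Subgroup.closure (S : Set G) ≤ (AddMonoidHom.toMultiplicativeRight φ).ker := by
      rw [Subgroup.closure_le]
      intro t ht'
      have : φ (Additive.ofMul t) = 0 := by
        by_cases hts : (⟨t, ht'⟩ : S) = s
        · rw [← hts] at hs; exact hs
        · exact ht ⟨t, ht'⟩ hts
      exact this
    rw [hS] at hle
    refine DFunLike.ext _ _ fun x => ?_
    exact hle (Subgroup.mem_top x.toMul)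
  choose φ hφ hφ0 using hex
  have hli : LinearIndependent (ZMod p) φ := by
    rw [Fintype.linearIndependent_iff]
    intro c hc s
    have h1 := DFunLike.congr_fun hc (Additive.ofMul s.1)
    rw [AddMonoidHom.finsetSum_apply, Finset.sum_eq_single s] at h1
    · have h2 : c s * φ s (Additive.ofMul s.1) = 0 := h1
      exact (mul_eq_zero.mp h2).resolve_right (hφ s)
    · intro t _ hts
      have : c t * φ t (Additive.ofMul s.1) = 0 := by rw [hφ0 t s hts.symm, mul_zero]
      exact this
    · simp
  have := hli.fintype_card_le_finrank
  rwa [Fintype.card_coe] at this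

theorem homRank_eq_zero_of_subsingleton (G : Type*) [Group G] [Subsingleton G] :
    homRank p G = 0 := by
  have : Subsingleton (Additive G →+ ZMod p) := ⟨fun a b => by
    refine DFunLike.ext _ _ fun x => ?_
    rw [Subsingleton.elim x 0, map_zero, map_zero]⟩
  exact Module.finrank_zero_of_subsingleton

/-- Restriction of homomorphisms to `ℤ/p` to a subgroup. -/
def homRestrict {P : Type*} [Group P] (N : Subgroup P) :
    (Additive P →+ ZMod p) →ₗ[ZMod p] (Additive N →+ ZMod p) where
  toFun φ := φ.comp (MonoidHom.toAdditive N.subtype)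
  map_add' _ _ := rfl
  map_smul' _ _ := rfl

/-- Left exactness of `Hom(-, ℤ/p)`, with the restrictions to the kernel confined to `X`. -/
theorem homRank_le_add_finrank {P Q : Type*} [Group P] [Group Q] [Finite P] [Finite Q] (f : P →* Q)
    (hf : Function.Surjective f) (X : Submodule (ZMod p) (Additive f.ker →+ ZMod p))
    (hX : ∀ φ : Additive P →+ ZMod p, homRestrict f.ker φ ∈ X) :
    homRank p P ≤ homRank p Q + Module.finrank (ZMod p) X := by
  let pull : (Additive Q →+ ZMod p) →ₗ[ZMod p] (Additive P →+ ZMod p) :=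
    { toFun := fun φ => φ.comp (MonoidHom.toAdditive f)
      map_add' := fun _ _ => rfl
      map_smul' := fun _ _ => rfl }
  have h1 := LinearMap.finrank_range_add_finrank_ker (homRestrict (p := p) f.ker)
  have h2 : Module.finrank (ZMod p) (LinearMap.range (homRestrict (p := p) f.ker)) ≤
      Module.finrank (ZMod p) X := by
    apply Submodule.finrank_mono
    rintro _ ⟨φ, rfl⟩
    exact hX φ
  have h3 : Module.finrank (ZMod p) (LinearMap.ker (homRestrict (p := p) f.ker)) ≤ homRank p Q := by
    refine le_trans (Submodule.finrank_mono (t := LinearMap.range pull) ?_)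
      (LinearMap.finrank_range_le pull)
    intro φ hφ
    have hle : f.ker ≤ (AddMonoidHom.toMultiplicativeRight φ).ker := by
      intro x hx
      exact DFunLike.congr_fun (LinearMap.mem_ker.mp hφ) (Additive.ofMul (⟨x, hx⟩ : f.ker))
    refine ⟨MonoidHom.toAdditiveLeft (f.liftOfSurjective hf ⟨_, hle⟩), ?_⟩
    refine DFunLike.ext _ _ fun x => ?_
    exact f.liftOfRightInverse_comp_apply _ (Function.rightInverse_surjInv hf) ⟨_, hle⟩ x.toMul
  unfold homRank at *
  omega

theorem homRank_le_add_homRank_ker {P Q : Type*} [Group P] [Group Q] [Finite P] [Finite Q]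
    (f : P →* Q) (hf : Function.Surjective f) : homRank p P ≤ homRank p Q + homRank p f.ker := by
  have := homRank_le_add_finrank (p := p) f hf ⊤ fun _ => trivial
  rwa [finrank_top] at this

/-- The homomorphisms `N → ℤ/p` invariant under conjugation by `y`. -/
def invariantHoms {P : Type*} [Group P] (N : Subgroup P) [N.Normal] (y : P) :
    Submodule (ZMod p) (Additive N →+ ZMod p) where
  carrier := {φ | ∀ b : N, φ (Additive.ofMul (MulAut.conjNormal y b)) = φ (Additive.ofMul b)}
  add_mem' ha hb b := by simp [ha b, hb b]
  zero_mem' b := rfl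
  smul_mem' c φ h b := by simp [h b]

theorem homRestrict_mem_invariantHoms {P : Type*} [Group P] (N : Subgroup P) [N.Normal] (y : P)
    (φ : Additive P →+ ZMod p) : homRestrict N φ ∈ invariantHoms N y := by
  intro b
  have : φ (Additive.ofMul (y * b.1 * y⁻¹)) = φ (Additive.ofMul b.1) := by
    rw [ofMul_mul, ofMul_mul, ofMul_inv, map_add, map_add, map_neg]; abel
  exact this

/-- For an elementary abelian normal subgroup, coinvariants and invariants have the same size. -/
theorem pow_finrank_invariantHoms_le {P : Type*} [Group P] (N : Subgroup P) [N.Normal] [Finite N]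
    (hcomm : ∀ a b : N, a * b = b * a) (hpow : ∀ a : N, a ^ p = 1) (y : P) :
    p ^ Module.finrank (ZMod p) (invariantHoms (p := p) N y) ≤
      Nat.card {b : N // MulAut.conjNormal y b = b} := by
  let _ : CommGroup N := { (inferInstance : Group N) with mul_comm := hcomm }
  let _ : Module (ZMod p) (Additive N) := AddCommGroup.zmodModule (n := p) hpow
  let c : Additive N →ₗ[ZMod p] Additive N :=
    AddMonoidHom.toZModLinearMap p (MonoidHom.toAdditive (MulAut.conjNormal y : MulAut N).toMonoidHom)
  -- Elements fixed by y are the kernel of T, and invariant homomorphisms lie in the kernel of its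
  -- transpose. The two kernels have equal dimension because T and its transpose have equal rank.
  let T : Additive N →ₗ[ZMod p] Additive N := c - LinearMap.id
  have h1 : Module.finrank (ZMod p) (invariantHoms (p := p) N y) ≤
      Module.finrank (ZMod p) (LinearMap.ker T.dualMap) := by
    let F : invariantHoms (p := p) N y →ₗ[ZMod p] LinearMap.ker T.dualMap :=
      { toFun := fun φ => ⟨AddMonoidHom.toZModLinearMap p φ.1, by
          rw [LinearMap.mem_ker]
          ext b
          have := φ.2 b.toMul
          change φ.1 (c b - b) = 0
          rw [map_sub, sub_eq_zero]
          exact this⟩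
        map_add' := fun _ _ => rfl
        map_smul' := fun _ _ => rfl }
    refine LinearMap.finrank_le_finrank_of_injective (f := F) ?_
    intro φ ψ h
    have h' := congrArg Subtype.val h
    exact Subtype.ext (AddMonoidHom.toZModLinearMap_injective p h')
  have h2 : Module.finrank (ZMod p) (LinearMap.ker T.dualMap) =
      Module.finrank (ZMod p) (LinearMap.ker T) := by
    have ha := LinearMap.finrank_range_add_finrank_ker T.dualMap
    have hb := LinearMap.finrank_range_add_finrank_ker T
    rw [LinearMap.finrank_range_dualMap_eq_finrank_range] at ha
    have hd : Module.finrank (ZMod p) (Module.Dual (ZMod p) (Additive N)) =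
      Module.finrank (ZMod p) (Additive N) := Subspace.dual_finrank_eq
    omega
  have h3 : Nat.card (LinearMap.ker T) = p ^ Module.finrank (ZMod p) (LinearMap.ker T) := by
    rw [Module.natCard_eq_pow_finrank (K := ZMod p), Nat.card_zmod]
  calc p ^ Module.finrank (ZMod p) (invariantHoms (p := p) N y)
      ≤ p ^ Module.finrank (ZMod p) (LinearMap.ker T) :=
        Nat.pow_le_pow_right hp.1.pos (h1.trans h2.le)
    _ = Nat.card (LinearMap.ker T) := h3.symm
    _ ≤ _ := by
      refine Nat.card_le_card_of_injective
        (fun b => ⟨b.1.toMul, ?_⟩) ?_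
      · have h4 : c b.1 - b.1 = 0 := b.2
        have h5 : c b.1 = b.1 := sub_eq_zero.mp h4
        exact h5
      intro a b hab
      have h5 := Subtype.ext_iff.mp hab
      exact Subtype.ext h5

end HomRank

/-! ### Permutation `p`-groups: at most n / p independent homomorphisms to ℤ/p -/

section PermutationGroups

open MulAction

universe u

/-- The action on the orbits of a central element. -/
@[reducible]
def MulAction.onZpowersOrbits {P : Type*} [Group P] (Ω : Type*) [MulAction P Ω] {z : P}
    (hz : ∀ g, Commute z g) : MulAction P (orbitRel.Quotient (Subgroup.zpowers z) Ω) where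
  smul g := Quotient.map (fun ω => g • ω) (by
    rintro _ b ⟨⟨_, k, rfl⟩, rfl⟩
    refine ⟨⟨_, k, rfl⟩, ?_⟩
    change z ^ k • g • b = g • z ^ k • b
    rw [smul_smul, smul_smul, ((hz g).zpow_left k).eq])
  one_smul := by
    rintro ⟨ω⟩
    exact congrArg _ (one_smul P ω)
  mul_smul := by
    rintro g h ⟨ω⟩
    exact congrArg _ (mul_smul g h ω)

theorem MulAction.mul_card_quotient_le {L Ω : Type*} [Group L] [MulAction L Ω] [Finite Ω] {m : ℕ}
    (h : ∀ ω : Ω, m ≤ Nat.card (orbit L ω)) : m * Nat.card (orbitRel.Quotient L Ω) ≤ Nat.card Ω := by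
  classical
  have : Fintype Ω := Fintype.ofFinite Ω
  have : Fintype (orbitRel.Quotient L Ω) := Fintype.ofFinite _
  rw [Nat.card_congr (selfEquivSigmaOrbits L Ω), Nat.card_sigma, Nat.card_eq_fintype_card, mul_comm,
    ← smul_eq_mul, ← Finset.card_univ]
  exact Finset.card_nsmul_le_sum _ _ _ fun q _ => h _

theorem MulAction.smul_eq_of_smul_eq_of_commute {P Ω : Type*} [Group P] [MulAction P Ω]
    [IsPretransitive P Ω] {z : P} (hz : ∀ g, Commute z g) {ω : Ω} (h : z • ω = ω) (x : Ω) :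
    z • x = x := by
  obtain ⟨g, rfl⟩ := exists_smul_eq P ω x
  rw [smul_smul, (hz g).eq, mul_smul, h]

theorem MulAction.card_orbit_zpowers {P Ω : Type*} [Group P] [MulAction P Ω] {p : ℕ}
    [hp : Fact p.Prime] {z : P} (hzp : z ^ p = 1) {ω : Ω} (h : z • ω ≠ ω) :
    Nat.card (orbit (Subgroup.zpowers z) ω) = p := by
  have h1 : Function.minimalPeriod (z • ·) ω = p := by
    refine Function.minimalPeriod_eq_prime ?_ ?_
    · rw [Function.IsPeriodicPt, Function.IsFixedPt, smul_iterate, hzp]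
      exact one_smul P ω
    · exact h
  rw [Nat.card_congr (MulAction.orbitZPowersEquiv z ω), Nat.card_zmod, h1]

section Permutation

variable {p : ℕ} [hp : Fact p.Prime] {P : Type*} [Group P] [Finite P] {Ω : Type*} [MulAction P Ω]
  [Finite Ω] [FaithfulSMul P Ω]

/-- The transitive step: a bound on the homomorphisms on the kernel of the action on the orbits
of a central element. -/
theorem finrank_invariantHoms_ker_le {z : P} (hz : ∀ g, Commute z g) (hzp : z ^ p = 1)
    (y : P) (N : Subgroup P) [N.Normal]
    (hN : ∀ b ∈ N, ∀ ω : Ω, ∃ k : ℤ, b • ω = z ^ k • ω) :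
    Module.finrank (ZMod p) (invariantHoms (p := p) N y) ≤
      Nat.card (orbitRel.Quotient (Subgroup.closure {z, y}) Ω) := by
  have hpow : ∀ b ∈ N, ∀ ω : Ω, ∀ k : ℤ, b • ω = z ^ k • ω → ∀ n : ℕ,
      b ^ n • ω = (z ^ k) ^ n • ω := by
    intro b _ ω k h n
    induction n with
    | zero => simp
    | succ n ih =>
      rw [pow_succ', mul_smul, ih, smul_smul, ← (((hz b).zpow_left k).pow_left n).eq, mul_smul, h,
        smul_smul, ← pow_succ]
  have hexp : ∀ k : ℤ, (z ^ k) ^ p = 1 := fun k => by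
    rw [← zpow_natCast, ← zpow_mul, mul_comm, zpow_mul, zpow_natCast, hzp, one_zpow]
  refine (Nat.pow_le_pow_iff_right hp.1.one_lt).mp
    ((pow_finrank_invariantHoms_le N ?_ ?_ y).trans ?_)
  · intro a b
    refine Subtype.ext (FaithfulSMul.eq_of_smul_eq_smul (α := Ω) fun ω => ?_)
    obtain ⟨k, hk⟩ := hN a a.2 ω
    obtain ⟨l, hl⟩ := hN b b.2 ω
    change (a.1 * b.1) • ω = (b.1 * a.1) • ω
    rw [mul_smul, mul_smul, hk, hl, smul_smul, smul_smul, ← ((hz a.1).zpow_left l).eq,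
      ← ((hz b.1).zpow_left k).eq, mul_smul, mul_smul, hk, hl, smul_smul, smul_smul,
      ((Commute.refl z).zpow_zpow k l).eq]
  · intro a
    refine Subtype.ext (FaithfulSMul.eq_of_smul_eq_smul (α := Ω) fun ω => ?_)
    obtain ⟨k, hk⟩ := hN a a.2 ω
    change a.1 ^ p • ω = (1 : P) • ω
    rw [hpow a a.2 ω k hk, hexp]
  -- An element of N fixed under conjugation by y commutes with all of ⟨z, y⟩. It is therefore
  -- determined by which power of z it agrees with at one point of each ⟨z, y⟩-orbit.
  · set O := orbitRel.Quotient (Subgroup.closure {z, y}) Ω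
    have hex : ∀ b : N, ∀ ω : Ω, ∃ k : Fin p, b.1 • ω = z ^ k.1 • ω := by
      intro b ω
      obtain ⟨k, hk⟩ := hN b b.2 ω
      obtain ⟨i, hi, hki⟩ := exists_pow_eq_zpow hzp k
      exact ⟨⟨i, hi⟩, by rw [hk, hki]⟩
    choose k hk using hex
    have hcard : Nat.card (O → Fin p) = p ^ Nat.card O := by rw [Nat.card_fun, Nat.card_fin]
    rw [← hcard]
    refine Nat.card_le_card_of_injective (fun b o => k b.1 o.out) ?_
    intro a b hab
    refine Subtype.ext (Subtype.ext (FaithfulSMul.eq_of_smul_eq_smul (α := Ω) fun ω => ?_))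
    have hcy : ∀ c : {b : N // MulAut.conjNormal y b = b}, Commute c.1.1 y := by
      intro c
      have h : y * c.1.1 * y⁻¹ = c.1.1 := congrArg Subtype.val c.2
      exact (mul_inv_eq_iff_eq_mul.mp h).symm
    have hcl : ∀ g ∈ Subgroup.closure {z, y}, ∀ c : {b : N // MulAut.conjNormal y b = b},
        Commute g c.1.1 := by
      intro g hg c
      have hle : Subgroup.closure {z, y} ≤ Subgroup.centralizer {c.1.1} := by
        rw [Subgroup.closure_le]
        rintro x (rfl | rfl)
        · exact Subgroup.mem_centralizer_singleton_iff.mpr (hz _)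
        · exact Subgroup.mem_centralizer_singleton_iff.mpr (hcy c).symm
      exact Subgroup.mem_centralizer_singleton_iff.mp (hle hg)
    obtain ⟨⟨g, hg⟩, hgω⟩ : ω ∈ orbit (Subgroup.closure {z, y}) (Quotient.mk _ ω : O).out :=
      (orbitRel_apply.mp (Quotient.exact (Quotient.out_eq (Quotient.mk _ ω : O)).symm))
    have hgω' : g • (Quotient.mk _ ω : O).out = ω := hgω
    rw [← hgω', smul_smul, smul_smul, ← (hcl g hg a).eq, ← (hcl g hg b).eq, mul_smul, mul_smul,
      hk, hk]
    have := congrFun hab (Quotient.mk _ ω : O)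
    simp only at this
    rw [this]

end Permutation

/-- A central z of order p moves every point; let I be the set of its orbits, so |Ω| = p|I|. The
kernel of the action on I is elementary abelian, but bounding its homomorphisms by |I| would be too
weak. Those that extend to P are invariant under conjugation by any y, so the number of ⟨z,
y⟩-orbits bounds their dimension. When y lifts a central element of order p of the image, these
orbits have at least p ^ 2 points, and the kernel contributes at most |I| / p. -/
theorem MulAction.homRank_transitive_bound {p : ℕ} [hp : Fact p.Prime] {P : Type*} {Ω : Type u} [Group P]
    [Finite P] [MulAction P Ω] [Finite Ω] [FaithfulSMul P Ω] [IsPretransitive P Ω] [Nonempty Ω]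
    [Nontrivial P] (hP : IsPGroup p P)
    (ih : ∀ (I : Type u) [Finite I] [MulAction P I], Nat.card I < Nat.card Ω →
      p * homRank p (toPermHom P I).range ≤ Nat.card I) :
    p * homRank p P ≤ Nat.card Ω := by
  obtain ⟨z, hzc, hzp, hz1⟩ := hP.exists_mem_center_pow_prime_eq_one
  have hz : ∀ g, Commute z g := fun g => (Subgroup.mem_center_iff.mp hzc g).symm
  have hfree : ∀ ω : Ω, z • ω ≠ ω := by
    intro ω h
    refine hz1 (FaithfulSMul.eq_of_smul_eq_smul (α := Ω) fun x => ?_)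
    rw [smul_eq_of_smul_eq_of_commute hz h, one_smul]
  have horb : ∀ ω : Ω, Nat.card (orbit (Subgroup.zpowers z) ω) = p := fun ω =>
    card_orbit_zpowers hzp (hfree ω)
  let I := orbitRel.Quotient (Subgroup.zpowers z) Ω
  let _ : MulAction P I := onZpowersOrbits Ω hz
  have hmk : ∀ (g : P) (ω : Ω), g • (Quotient.mk _ ω : I) = Quotient.mk _ (g • ω) := fun _ _ => rfl
  have hmkeq : ∀ a b : Ω, (Quotient.mk _ a : I) = Quotient.mk _ b → ∃ k : ℤ, a = z ^ k • b := by
    intro a b h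
    obtain ⟨⟨_, k, rfl⟩, hk⟩ := orbitRel_apply.mp (Quotient.exact h)
    exact ⟨k, hk.symm⟩
  have hI : p * Nat.card I ≤ Nat.card Ω := mul_card_quotient_le fun ω => (horb ω).ge
  have hIpos : 0 < Nat.card I := by
    have : Nonempty I := ⟨Quotient.mk _ (Classical.arbitrary Ω)⟩
    exact Nat.card_pos
  have hlt : Nat.card I < Nat.card Ω :=
    lt_of_lt_of_le (lt_mul_of_one_lt_left hIpos hp.1.one_lt) hI
  have hQ := ih I hlt
  let f : P →* (toPermHom P I).range := (toPermHom P I).rangeRestrict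
  have hf : Function.Surjective f := (toPermHom P I).rangeRestrict_surjective
  have hker : ∀ b : P, b ∈ f.ker ↔ ∀ i : I, b • i = i := by
    intro b
    rw [MonoidHom.ker_rangeRestrict, MonoidHom.mem_ker]
    exact ⟨fun h i => congrArg (fun e : Equiv.Perm I => e i) h, fun h => Equiv.ext h⟩
  have hN : ∀ b ∈ f.ker, ∀ ω : Ω, ∃ k : ℤ, b • ω = z ^ k • ω := fun b hb ω =>
    hmkeq _ _ (by rw [← hmk]; exact (hker b).mp hb _)
  have hbound : ∀ y : P, homRank p P ≤ homRank p (toPermHom P I).range +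
      Nat.card (orbitRel.Quotient (Subgroup.closure {z, y}) Ω) := fun y =>
    (homRank_le_add_finrank f hf (invariantHoms f.ker y)
      (fun φ => homRestrict_mem_invariantHoms _ _ φ)).trans
      (Nat.add_le_add_left (finrank_invariantHoms_ker_le hz hzp y f.ker hN) _)
  have hzL : ∀ y : P, z ∈ Subgroup.closure {z, y} := fun y => Subgroup.subset_closure (by simp)
  have hsub : ∀ (y : P) (ω : Ω), orbit (Subgroup.zpowers z) ω ⊆ orbit (Subgroup.closure {z, y}) ω := by
    rintro y ω _ ⟨⟨g, hg⟩, rfl⟩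
    exact ⟨⟨g, (Subgroup.zpowers_le.mpr (hzL y)) hg⟩, rfl⟩
  have htrans : IsPretransitive P I := ⟨by
    rintro ⟨a⟩ ⟨b⟩
    obtain ⟨g, rfl⟩ := exists_smul_eq P a b
    exact ⟨g, rfl⟩⟩
  by_cases hnt : Nontrivial (toPermHom P I).range
  · have hQP : IsPGroup p (toPermHom P I).range := hP.of_surjective f hf
    obtain ⟨t, htc, htp, ht1⟩ := hQP.exists_mem_center_pow_prime_eq_one
    obtain ⟨y, rfl⟩ := hf t
    have hyfree : ∀ i : I, y • i ≠ i := by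
      intro i h
      refine ht1 (MonoidHom.mem_ker.mp ((hker y).mpr fun x => ?_))
      obtain ⟨g, rfl⟩ := exists_smul_eq P i x
      have h1 : (f y * f g : (toPermHom P I).range).1 i = (f g * f y : (toPermHom P I).range).1 i := by
        rw [Subgroup.mem_center_iff.mp htc (f g)]
      have h2 : y • g • i = g • y • i := h1
      rw [h2, h]
    -- The orbit properly contains a z-orbit of p points, since y moves every z-orbit, and its size
    -- is a power of p.
    have hL : ∀ ω : Ω, p ^ 2 ≤ Nat.card (orbit (Subgroup.closure {z, y}) ω) := by
      intro ω
      obtain ⟨n, hn⟩ := (hP.to_subgroup (Subgroup.closure {z, y})).card_orbit ω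
      have h1 : Nat.card (orbit (Subgroup.zpowers z) ω) <
          Nat.card (orbit (Subgroup.closure {z, y}) ω) := by
        refine Set.ncard_lt_ncard (s := orbit (Subgroup.zpowers z) ω)
          (t := orbit (Subgroup.closure {z, y}) ω) ⟨hsub y ω, fun h => ?_⟩ (Set.toFinite _)
        have h2 : y • ω ∈ orbit (Subgroup.zpowers z) ω :=
          h ⟨⟨y, Subgroup.subset_closure (by simp)⟩, rfl⟩
        refine hyfree (Quotient.mk _ ω) ?_
        rw [hmk]
        exact Quotient.sound (orbitRel_apply.mpr h2)
      rw [horb, hn] at h1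
      rw [hn]
      refine Nat.pow_le_pow_right hp.1.pos ?_
      by_contra hn2
      have : p ^ n ≤ p ^ 1 := Nat.pow_le_pow_right hp.1.pos (by omega)
      rw [pow_one] at this
      omega
    have hO := mul_card_quotient_le hL
    have hb := hbound y
    have hΩ : Nat.card Ω = p * Nat.card I := by
      have : Fintype I := Fintype.ofFinite I
      rw [Nat.card_congr (selfEquivSigmaOrbits (Subgroup.zpowers z) Ω), Nat.card_sigma,
        Finset.sum_congr rfl fun i _ => horb _, Finset.sum_const, Finset.card_univ,
        ← Nat.card_eq_fintype_card, smul_eq_mul, mul_comm]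
    set o := Nat.card (orbitRel.Quotient (Subgroup.closure {z, y}) Ω)
    rw [hΩ] at hO ⊢
    have h3 : p * o ≤ Nat.card I := by
      rw [pow_two, mul_assoc] at hO
      exact Nat.le_of_mul_le_mul_left hO hp.1.pos
    -- The image and the kernel each contribute at most |I|, and 2 ≤ p.
    calc p * homRank p P ≤ p * (homRank p (toPermHom P I).range + o) := Nat.mul_le_mul_left _ hb
      _ ≤ 2 * Nat.card I := by rw [mul_add]; omega
      _ ≤ p * Nat.card I := Nat.mul_le_mul_right _ hp.1.two_le
  -- If the image is trivial, transitivity leaves a single z-orbit; y = 1 already gives the bound 1.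
  · rw [not_nontrivial_iff_subsingleton] at hnt
    have hI1 : ∀ i j : I, i = j := by
      intro i j
      obtain ⟨g, rfl⟩ := exists_smul_eq P i j
      exact ((hker g).mp (MonoidHom.mem_ker.mpr (Subsingleton.elim _ _)) i).symm
    have hone : Nat.card (orbitRel.Quotient (Subgroup.closure {z, 1}) Ω) ≤ 1 := by
      rw [Finite.card_le_one_iff_subsingleton]
      refine ⟨?_⟩
      rintro ⟨a⟩ ⟨b⟩
      exact Quotient.sound (orbitRel_apply.mpr (hsub 1 b (orbitRel_apply.mp
        (Quotient.exact (hI1 (Quotient.mk _ a) (Quotient.mk _ b))))))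
    have hb := hbound 1
    rw [homRank_eq_zero_of_subsingleton (toPermHom P I).range] at hb
    calc p * homRank p P ≤ p * 1 := Nat.mul_le_mul_left _ (by omega)
      _ ≤ p * Nat.card I := Nat.mul_le_mul_left _ hIpos
      _ ≤ Nat.card Ω := hI

/-- A `p`-group of permutations of `n` points has at most `n / p` independent homomorphisms
to `ℤ/p`. -/
theorem IsPGroup.mul_homRank_le_card {p : ℕ} [hp : Fact p.Prime] {P Ω : Type u} [Group P]
    [Finite P] [MulAction P Ω] [Finite Ω] [FaithfulSMul P Ω] (hP : IsPGroup p P) :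
    p * homRank p P ≤ Nat.card Ω := by
  induction hn : Nat.card Ω using Nat.strong_induction_on generalizing P Ω with
  | _ n ih =>
  subst hn
  have ih' : ∀ (I : Type u) [Finite I] [MulAction P I], Nat.card I < Nat.card Ω →
      p * homRank p (toPermHom P I).range ≤ Nat.card I := fun I _ _ hI =>
    ih _ hI (P := (toPermHom P I).range) (Ω := I)
      (hP.of_surjective _ (toPermHom P I).rangeRestrict_surjective) rfl
  by_cases hs : Subsingleton P
  · rw [homRank_eq_zero_of_subsingleton P]; simp
  have hnt : Nontrivial P := not_subsingleton_iff_nontrivial.mp hs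
  have hne : Nonempty Ω := by
    by_contra hne
    rw [not_nonempty_iff] at hne
    obtain ⟨a, b, hab⟩ := hnt
    exact hab (FaithfulSMul.eq_of_smul_eq_smul (α := Ω) fun x => hne.elim x)
  by_cases ht : IsPretransitive P Ω
  · exact homRank_transitive_bound hP ih'
  obtain ⟨ω⟩ := hne
  -- In the intransitive case split off one orbit: the image of P acts faithfully on it, and the
  -- kernel of that action acts faithfully on the complement. Both sets are smaller, and the bounds
  -- add.
  let O : SubMulAction P Ω := ⟨orbit P ω, fun g _ hx => (mapsTo_smul_orbit g ω) hx⟩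
  let O' : SubMulAction P Ω := Oᶜ
  have hcard : Nat.card O + Nat.card O' = Nat.card Ω := by
    exact Set.ncard_add_ncard_compl (orbit P ω)
  have hO : 0 < Nat.card O := by
    have : Nonempty O := ⟨⟨ω, mem_orbit_self ω⟩⟩
    exact Nat.card_pos
  have hO' : 0 < Nat.card O' := by
    by_contra h0
    refine ht ⟨?_⟩
    have hall : ∀ x : Ω, x ∈ orbit P ω := by
      intro x
      by_contra hx
      have : Nonempty O' := ⟨⟨x, hx⟩⟩
      exact h0 Nat.card_pos
    intro x y
    obtain ⟨g, rfl⟩ := hall x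
    obtain ⟨h, rfl⟩ := hall y
    exact ⟨h * g⁻¹, by simp [mul_smul]⟩
  let f : P →* (toPermHom P O).range := (toPermHom P O).rangeRestrict
  have hf : Function.Surjective f := (toPermHom P O).rangeRestrict_surjective
  have h1 := homRank_le_add_homRank_ker (p := p) f hf
  have h2 := ih' O (by omega)
  have hfaith : FaithfulSMul f.ker O' := ⟨by
    intro a b hab
    refine Subtype.ext (FaithfulSMul.eq_of_smul_eq_smul (α := Ω) fun x => ?_)
    by_cases hx : x ∈ orbit P ω
    · have hfix : ∀ c : f.ker, c.1 • x = x := by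
        intro c
        have hc : toPermHom P O c.1 = 1 := congrArg Subtype.val (MonoidHom.mem_ker.mp c.2)
        exact congrArg (fun e : Equiv.Perm O => (e ⟨x, hx⟩).1) hc
      rw [hfix, hfix]
    · exact congrArg Subtype.val (hab ⟨x, hx⟩)⟩
  have h3 := ih _ (show Nat.card O' < Nat.card Ω by omega) (P := f.ker) (Ω := O')
    (hP.to_subgroup _) rfl
  calc p * homRank p P ≤ p * (homRank p (toPermHom P O).range + homRank p f.ker) :=
        Nat.mul_le_mul_left _ h1
    _ ≤ Nat.card Ω := by rw [mul_add]; omega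

end PermutationGroups

/-! ### Irreducibility of `p`-power cyclotomic polynomials over ℚ_p -/

namespace Polynomial

/-- After the substitution X + 1 the polynomial is Eisenstein at p already over ℤ, with constant
term its value p at 1. This persists over ℤ_p, where p remains prime, and Gauss's lemma passes to
ℚ_p. -/
theorem irreducible_cyclotomic_prime_pow_padic (p : ℕ) [hp : Fact p.Prime] (n : ℕ) :
    Irreducible (cyclotomic (p ^ (n + 1)) ℚ_[p]) := by
  have hm : (cyclotomic (p ^ (n + 1)) ℤ_[p]).Monic := cyclotomic.monic _ _
  have hprime : (Ideal.span {(p : ℤ_[p])}).IsPrime :=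
    (Ideal.span_singleton_prime PadicInt.prime_p.ne_zero).mpr PadicInt.prime_p
  have h1 : Irreducible (cyclotomic (p ^ (n + 1)) ℤ_[p]) := by
    have hE := cyclotomic_prime_pow_comp_X_add_one_isEisensteinAt p n
    set f := (cyclotomic (p ^ (n + 1)) ℤ).comp (X + 1) with hf
    have hfm : f.Monic := (cyclotomic.monic _ _).comp (monic_X_add_C 1) (by
      rw [← C_1, natDegree_X_add_C]; exact one_ne_zero)
    have hfc : f.coeff 0 = p := by
      rw [hf, coeff_zero_eq_eval_zero, eval_comp]
      simp [eval_one_cyclotomic_prime_pow]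
    have hmap : f.map (Int.castRingHom ℤ_[p]) =
        taylorEquiv 1 (cyclotomic (p ^ (n + 1)) ℤ_[p]) := by
      rw [hf, map_comp, map_cyclotomic, Polynomial.map_add, map_X, Polynomial.map_one]
      change _ = taylor 1 _
      rw [taylor_apply, C_1]
    have hfm' : (f.map (Int.castRingHom ℤ_[p])).Monic := hfm.map _
    have hdeg : (f.map (Int.castRingHom ℤ_[p])).natDegree = f.natDegree := hfm.natDegree_map _
    have hE' : (f.map (Int.castRingHom ℤ_[p])).IsEisensteinAt (Ideal.span {(p : ℤ_[p])}) := by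
      refine hfm'.isEisensteinAt_of_mem_of_notMem hprime.ne_top ?_ ?_
      · intro i hi
        rw [hdeg] at hi
        have h := hE.mem hi
        rw [Ideal.mem_span_singleton] at h ⊢
        obtain ⟨c, hc⟩ := h
        rw [coeff_map, hc]
        exact ⟨c, by simp⟩
      · rw [coeff_map, hfc, Ideal.span_singleton_pow, Ideal.mem_span_singleton]
        rintro ⟨c, hc⟩
        have h0 : (p : ℤ_[p]) ≠ 0 := PadicInt.prime_p.ne_zero
        have hu : (p : ℤ_[p]) * c = 1 := by
          apply mul_left_cancel₀ h0
          rw [← mul_assoc, ← pow_two, ← hc]; simp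
        exact PadicInt.prime_p.not_isUnit (IsUnit.of_mul_eq_one _ hu)
    have hpos : 0 < (f.map (Int.castRingHom ℤ_[p])).natDegree := by
      rw [hdeg, hf, natDegree_comp, natDegree_cyclotomic, ← C_1, natDegree_X_add_C, mul_one]
      exact Nat.totient_pos.mpr (pow_pos hp.1.pos _)
    have hirr := hE'.irreducible hprime hfm'.isPrimitive hpos
    rw [hmap] at hirr
    exact (MulEquiv.irreducible_iff (taylorEquiv (1 : ℤ_[p]))).mp hirr
  have h2 := hm.irreducible_iff_irreducible_map_fraction_map (K := ℚ_[p])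
  rw [map_cyclotomic] at h2
  exact h2.mp h1

end Polynomial

/-! ### Maschke's theorem inside an invariant subspace -/

section Maschke

variable {K V : Type*} [Field K] [AddCommGroup V] [Module K V]

/-- The tautological representation of a group of automorphisms. -/
def autRepresentation (N : Subgroup (V ≃ₗ[K] V)) : Representation K N V where
  toFun g := (g.1 : V →ₗ[K] V)
  map_one' := rfl
  map_mul' _ _ := rfl

/-- Semisimplicity gives an invariant complement of U₁ in all of V; by the modular law its
intersection with U is a complement inside U. -/
theorem exists_invariant_complement [CharZero K] (N : Subgroup (V ≃ₗ[K] V)) [Finite N]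
    {U U₁ : Submodule K V} (hU : ∀ g ∈ N, ∀ u ∈ U, g u ∈ U) (hU₁ : ∀ g ∈ N, ∀ u ∈ U₁, g u ∈ U₁)
    (hle : U₁ ≤ U) :
    ∃ U₂ ≤ U, (∀ g ∈ N, ∀ u ∈ U₂, g u ∈ U₂) ∧ Disjoint U₁ U₂ ∧ U₁ ⊔ U₂ = U := by
  have : NeZero (Nat.card N : K) := ⟨by exact_mod_cast Nat.card_pos.ne'⟩
  have hss : Representation.IsSemisimpleRepresentation (autRepresentation N) := inferInstance
  let S : Subrepresentation (autRepresentation N) := ⟨U₁, fun g u hu => hU₁ g.1 g.2 u hu⟩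
  obtain ⟨T, hT⟩ := exists_isCompl S
  have hd : Disjoint U₁ T.toSubmodule := by
    rw [Submodule.disjoint_def]
    intro x hx hxT
    have := hT.disjoint.le_bot (show x ∈ S ⊓ T from ⟨hx, hxT⟩)
    exact this
  have hs : U₁ ⊔ T.toSubmodule = ⊤ := by
    rw [eq_top_iff]
    intro x _
    have := hT.codisjoint.top_le (show x ∈ (⊤ : Subrepresentation (autRepresentation N)) from trivial)
    exact this
  refine ⟨T.toSubmodule ⊓ U, inf_le_right, ?_, hd.mono_right inf_le_left, ?_⟩
  · intro g hg u hu
    exact ⟨T.apply_mem_toSubmodule ⟨g, hg⟩ hu.1, hU g hg u hu.2⟩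
  · rw [← sup_inf_assoc_of_le _ hle, hs, top_inf_eq]

end Maschke

/-! ### Monomial frames and pointwise fixers -/

section Frame

variable {K V : Type*} [Field K] [AddCommGroup V] [Module K V]

/-- The translates of the members of `R` under the powers of `z`. -/
def zpowOrbit (z : V ≃ₗ[K] V) (R : Finset V) : Set V := {x | ∃ v ∈ R, ∃ k : ℤ, x = (z ^ k) v}

/-- A finite set `R` of vectors permuted by `N` up to powers of `z`, whose `z`-translates span `U`,
of the minimal possible cardinality `dim U / (p - 1)`. -/
structure IsMonomialFrame (p : ℕ) (N : Subgroup (V ≃ₗ[K] V)) (z : V ≃ₗ[K] V) (U : Submodule K V)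
    (R : Finset V) : Prop where
  span_eq : Submodule.span K (zpowOrbit z R) = U
  perm : ∀ g ∈ N, ∀ v ∈ R, ∃ w ∈ R, ∃ k : ℤ, g v = (z ^ k) w
  card_le : (p - 1) * R.card ≤ Module.finrank K U

theorem IsMonomialFrame.zpow_mem {p : ℕ} {N : Subgroup (V ≃ₗ[K] V)} {z : V ≃ₗ[K] V}
    {U : Submodule K V} {R : Finset V} (h : IsMonomialFrame p N z U R) {v : V} (hv : v ∈ R) (k : ℤ) :
    (z ^ k) v ∈ U := by
  rw [← h.span_eq]
  exact Submodule.subset_span ⟨v, hv, k, rfl⟩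

theorem IsMonomialFrame.sup [FiniteDimensional K V] {p : ℕ} {N : Subgroup (V ≃ₗ[K] V)}
    {z : V ≃ₗ[K] V} {U₁ U₂ : Submodule K V} {R₁ R₂ : Finset V} [DecidableEq V]
    (h₁ : IsMonomialFrame p N z U₁ R₁) (h₂ : IsMonomialFrame p N z U₂ R₂) (hd : Disjoint U₁ U₂) :
    IsMonomialFrame p N z (U₁ ⊔ U₂) (R₁ ∪ R₂) where
  span_eq := by
    rw [← h₁.span_eq, ← h₂.span_eq, ← Submodule.span_union]
    congr 1
    ext x
    constructor
    · rintro ⟨v, hv, k, rfl⟩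
      rcases Finset.mem_union.mp hv with hv | hv
      · exact Or.inl ⟨v, hv, k, rfl⟩
      · exact Or.inr ⟨v, hv, k, rfl⟩
    · rintro (⟨v, hv, k, rfl⟩ | ⟨v, hv, k, rfl⟩)
      · exact ⟨v, Finset.mem_union_left _ hv, k, rfl⟩
      · exact ⟨v, Finset.mem_union_right _ hv, k, rfl⟩
  perm := by
    intro g hg v hv
    rcases Finset.mem_union.mp hv with hv | hv
    · obtain ⟨w, hw, k, h⟩ := h₁.perm g hg v hv
      exact ⟨w, Finset.mem_union_left _ hw, k, h⟩
    · obtain ⟨w, hw, k, h⟩ := h₂.perm g hg v hv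
      exact ⟨w, Finset.mem_union_right _ hw, k, h⟩
  card_le := by
    have h := Submodule.finrank_sup_add_finrank_inf_eq U₁ U₂
    rw [hd.eq_bot, finrank_bot, add_zero] at h
    rw [h]
    refine le_trans (Nat.mul_le_mul_left _ (Finset.card_union_le _ _)) ?_
    rw [mul_add]
    exact Nat.add_le_add h₁.card_le h₂.card_le

theorem span_zpowOrbit_invariant {N : Subgroup (V ≃ₗ[K] V)} {z : V ≃ₗ[K] V} {R : Finset V}
    (hz : ∀ g ∈ N, Commute z g) (perm : ∀ g ∈ N, ∀ v ∈ R, ∃ w ∈ R, ∃ k : ℤ, g v = (z ^ k) w) :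
    ∀ g ∈ N, ∀ u ∈ Submodule.span K (zpowOrbit z R), g u ∈ Submodule.span K (zpowOrbit z R) := by
  intro g hg u hu
  have hle : Submodule.span K (zpowOrbit z R) ≤
      (Submodule.span K (zpowOrbit z R)).comap (g : V →ₗ[K] V) := by
    rw [Submodule.span_le]
    rintro _ ⟨v, hv, k, rfl⟩
    obtain ⟨w, hw, l, hl⟩ := perm g hg v hv
    refine Submodule.subset_span ⟨w, hw, k + l, ?_⟩
    change (g * z ^ k) v = _
    rw [← ((hz g hg).zpow_left k).eq, zpow_add, LinearEquiv.mul_apply, LinearEquiv.mul_apply, hl]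
  exact hle hu

/-- The elements of `N` that fix `U` pointwise. -/
def pointwiseFixer (N : Subgroup (V ≃ₗ[K] V)) (U : Submodule K V) : Subgroup N where
  carrier := {g | ∀ u ∈ U, g.1 u = u}
  mul_mem' := by
    intro a b ha hb u hu
    change a.1 (b.1 u) = u
    rw [hb u hu, ha u hu]
  one_mem' _ _ := rfl
  inv_mem' := by
    intro a ha u hu
    change a.1⁻¹ u = u
    conv_lhs => rw [← ha u hu]
    exact LinearEquiv.symm_apply_apply _ _

theorem pointwiseFixer_normal {N : Subgroup (V ≃ₗ[K] V)} {U : Submodule K V}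
    (hU : ∀ g ∈ N, ∀ u ∈ U, g u ∈ U) : (pointwiseFixer N U).Normal := by
  refine ⟨fun a ha g u hu => ?_⟩
  change g.1 (a.1 (g.1⁻¹ u)) = u
  rw [ha _ (hU _ (N.inv_mem g.2) u hu)]
  exact LinearEquiv.apply_symm_apply _ _

theorem mk_eq_mk_iff_pointwiseFixer {N : Subgroup (V ≃ₗ[K] V)} {U : Submodule K V} {a b : N} :
    (a : N ⧸ pointwiseFixer N U) = b ↔ ∀ u ∈ U, a.1 u = b.1 u := by
  rw [QuotientGroup.eq]
  have h : ∀ u, (a⁻¹ * b).1 u = u ↔ a.1 u = b.1 u := by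
    intro u
    change a.1.symm (b.1 u) = u ↔ _
    rw [LinearEquiv.symm_apply_eq, eq_comm]
  exact forall₂_congr fun u _ => h u

theorem zpow_apply_mem {U : Submodule K V} {z : V ≃ₗ[K] V} (h : ∀ u ∈ U, z u ∈ U)
    (h' : ∀ u ∈ U, z⁻¹ u ∈ U) (k : ℤ) : ∀ u ∈ U, (z ^ k) u ∈ U := by
  induction k with
  | zero => intro u hu; exact hu
  | succ n ih => intro u hu; rw [zpow_add_one]; exact ih _ (h u hu)
  | pred n ih => intro u hu; rw [zpow_sub_one]; exact ih _ (h' u hu)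

section SumZero

variable {p : ℕ} [hp : Fact p.Prime] [CharZero K] {z : V ≃ₗ[K] V}

/-- If `1 + z + ⋯ + z ^ (p - 1)` kills `U` then so does the same expression in `z ^ m`. -/
theorem sum_zpow_eq_zero (hzp : z ^ p = 1) {U : Submodule K V} (hzU : ∀ u ∈ U, z u ∈ U)
    (hsum : ∀ u ∈ U, ∑ i ∈ Finset.range p, (z ^ i) u = 0) {m : ℤ} (hm : ¬ (p : ℤ) ∣ m)
    {u : V} (hu : u ∈ U) : ∑ j ∈ Finset.range p, ((z ^ m) ^ j) u = 0 := by
  have hzU' : ∀ u ∈ U, z⁻¹ u ∈ U := by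
    intro u hu
    have h1 : z⁻¹ = z ^ (p - 1) := by
      rw [inv_eq_iff_mul_eq_one, ← pow_succ', Nat.sub_add_cancel hp.1.pos, hzp]
    have h2 : ∀ n : ℕ, (z ^ n) u ∈ U := by
      intro n
      induction n with
      | zero => exact hu
      | succ n ih => rw [pow_succ']; exact hzU _ ih
    rw [h1]; exact h2 _
  set S := ∑ j ∈ Finset.range p, ((z ^ m) ^ j) u with hS
  have hSU : S ∈ U := Submodule.sum_mem _ fun j _ => by
    rw [← zpow_natCast, ← zpow_mul]; exact zpow_apply_mem hzU hzU' _ u hu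
  have hmS : (z ^ m) S = S := by
    have h1 : (z ^ m) S = ∑ j ∈ Finset.range p, ((z ^ m) ^ (j + 1)) u := by
      rw [hS, map_sum]
      exact Finset.sum_congr rfl fun j _ => by rw [pow_succ']; rfl
    have h2 := Finset.sum_range_succ' (fun j => ((z ^ m) ^ j) u) p
    rw [Finset.sum_range_succ, pow_zero, ← zpow_natCast, ← zpow_mul, mul_comm, zpow_mul,
      zpow_natCast, hzp, one_zpow] at h2
    rw [h1, hS]
    exact (add_right_cancel h2).symm
  have hmS' : ∀ n : ℤ, ((z ^ m) ^ n) S = S := by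
    have hst : z ^ m ∈ MulAction.stabilizer (V ≃ₗ[K] V) S := hmS
    intro n
    exact Subgroup.zpow_mem _ hst n
  have hcop : IsCoprime (p : ℤ) m :=
    (Nat.prime_iff_prime_int.mp hp.1).irreducible.coprime_iff_not_dvd.mpr hm
  obtain ⟨a, b, hab⟩ := hcop
  have hzS : ∀ i : ℕ, (z ^ i) S = S := by
    have h1 : z = (z ^ m) ^ b := by
      rw [← zpow_mul, mul_comm m]
      conv_lhs => rw [← zpow_one z, ← hab, zpow_add, mul_comm a, zpow_mul, zpow_natCast, hzp,
        one_zpow, one_mul]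
    intro i
    rw [h1, ← zpow_natCast, ← zpow_mul]
    exact hmS' _
  have h3 := hsum S hSU
  rw [Finset.sum_congr rfl fun i _ => hzS i, Finset.sum_const, Finset.card_range,
    ← Nat.cast_smul_eq_nsmul K, smul_eq_zero] at h3
  exact h3.resolve_left (by exact_mod_cast hp.1.ne_zero)

end SumZero

end Frame

theorem LinearEquiv.toLinearMap_pow {K V : Type*} [Field K] [AddCommGroup V] [Module K V]
    (g : V ≃ₗ[K] V) (i : ℕ) : (g : V →ₗ[K] V) ^ i = ((g ^ i : V ≃ₗ[K] V) : V →ₗ[K] V) := by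
  induction i with
  | zero => rfl
  | succ i ih => rw [pow_succ, ih, pow_succ]; rfl

/-! ### Frames when the group acts through a cyclic quotient -/

section Cyclic

variable {K V : Type*} [Field K] [AddCommGroup V] [Module K V] [FiniteDimensional K V]
variable {p : ℕ} [hp : Fact p.Prime]

open Polynomial in
-- A nonzero q of degree below deg f is coprime to f, so a Bézout relation shows that q(g) cannot
-- kill v as well. Hence q ↦ q(g) v is injective on polynomials of degree below deg f.
theorem natDegree_le_finrank_of_aeval_eq_zero {f : K[X]} (hf : Irreducible f) {g : Module.End K V}
    {v : V} (hv : v ≠ 0) (hfv : aeval g f v = 0) {W : Submodule K V} (hW : ∀ i : ℕ, (g ^ i) v ∈ W) :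
    f.natDegree ≤ Module.finrank K W := by
  have hmem : ∀ q : K[X], aeval g q v ∈ W := by
    intro q
    rw [aeval_eq_sum_range, LinearMap.sum_apply]
    exact Submodule.sum_mem _ fun i _ => Submodule.smul_mem _ _ (hW i)
  let F : degreeLT K f.natDegree →ₗ[K] W :=
    { toFun := fun q => ⟨aeval g q.1 v, hmem q.1⟩
      map_add' := fun a b => Subtype.ext (by simp)
      map_smul' := fun c a => Subtype.ext (by simp) }
  have hF : Function.Injective F := by
    rw [injective_iff_map_eq_zero]
    intro q hq
    have hq0 : aeval g q.1 v = 0 := congrArg Subtype.val hq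
    by_contra hne
    have hq1 : q.1 ≠ 0 := fun h => hne (Subtype.ext h)
    have hnd : ¬ f ∣ q.1 := fun h => by
      have h1 := degree_le_of_dvd h hq1
      have h2 := mem_degreeLT.mp q.2
      rw [degree_eq_natDegree hf.ne_zero] at h1
      exact absurd h2 (not_lt.mpr h1)
    obtain ⟨a, b, hab⟩ := hf.coprime_iff_not_dvd.mpr hnd
    apply hv
    have h3 : aeval g (a * f + b * q.1) v = v := by rw [hab]; simp
    rw [← h3]
    simp [hfv, hq0]
  have h := LinearMap.finrank_le_finrank_of_injective hF
  rwa [(degreeLTEquiv K f.natDegree).finrank_eq, Module.finrank_fin_fun] at h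

/-- Let g generate the quotient, of order p ^ (n + 1). Since z has order p there, g ^ p ^ n acts on
U as z ^ j with p ∤ j, so the vectors g ^ i v with i < p ^ n are permuted up to powers of z. The
cyclotomic polynomial of order p ^ (n + 1) at g is 1 + z ^ j + ⋯ + z ^ (j * (p - 1)) on v, which is
zero; irreducibility then makes the span at least (p - 1) * p ^ n dimensional. -/
theorem exists_monomialFrame_of_isCyclic [CharZero K]
    (hirr : ∀ n : ℕ, Irreducible (Polynomial.cyclotomic (p ^ (n + 1)) K))
    {N : Subgroup (V ≃ₗ[K] V)} [Finite N] (hN : IsPGroup p N) {z : V ≃ₗ[K] V} (hzN : z ∈ N)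
    (hzp : z ^ p = 1) {U : Submodule K V} (hU0 : U ≠ ⊥)
    (hU : ∀ g ∈ N, ∀ u ∈ U, g u ∈ U)
    (hsum : ∀ u ∈ U, ∑ i ∈ Finset.range p, (z ^ i) u = 0)
    [hn : (pointwiseFixer N U).Normal] (hcyc : IsCyclic (N ⧸ pointwiseFixer N U)) :
    ∃ U₁ ≤ U, U₁ ≠ ⊥ ∧ ∃ R, IsMonomialFrame p N z U₁ R := by
  classical
  obtain ⟨v, hvU, hv0⟩ := Submodule.exists_mem_ne_zero_of_ne_bot hU0
  set Q := N ⧸ pointwiseFixer N U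
  obtain ⟨γ, hγ⟩ := IsCyclic.exists_generator (α := Q)
  obtain ⟨g, rfl⟩ := QuotientGroup.mk_surjective γ
  have hQ : IsPGroup p Q := hN.to_quotient _
  obtain ⟨n, hn⟩ := (IsPGroup.iff_orderOf.mp hQ) (g : Q)
  set ζ : Q := ((⟨z, hzN⟩ : N) : Q) with hζ
  have hζp : ζ ^ p = 1 := by
    rw [hζ, ← QuotientGroup.mk_pow]
    have : (⟨z, hzN⟩ : N) ^ p = 1 := Subtype.ext hzp
    rw [this]; rfl
  -- If z were trivial on U, the vanishing sum at v would be p • v.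
  have hζ1 : ζ ≠ 1 := by
    intro h
    have h1 : ∀ u ∈ U, z u = u := mk_eq_mk_iff_pointwiseFixer.mp h
    have h2 : ∀ i : ℕ, (z ^ i) v = v := by
      intro i
      induction i with
      | zero => rfl
      | succ i ih => rw [pow_succ, LinearEquiv.mul_apply, h1 v hvU, ih]
    have h3 := hsum v hvU
    rw [Finset.sum_congr rfl fun i _ => h2 i, Finset.sum_const, Finset.card_range,
      ← Nat.cast_smul_eq_nsmul K, smul_eq_zero] at h3
    exact h3.elim (by exact_mod_cast hp.1.ne_zero) hv0
  obtain ⟨k, hk⟩ := hγ ζ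
  simp only at hk
  rcases n with _ | n
  · rw [pow_zero, orderOf_eq_one_iff] at hn
    rw [hn, one_zpow] at hk
    exact absurd hk.symm hζ1
  have hη1 : (g : Q) ^ p ^ n ≠ 1 := by
    intro h
    have := orderOf_dvd_of_pow_eq_one h
    rw [hn] at this
    have := (Nat.pow_dvd_pow_iff_le_right hp.1.one_lt).mp this
    omega
  have hηp : ((g : Q) ^ p ^ n) ^ p = 1 := by
    rw [← pow_mul, ← pow_succ, ← hn, pow_orderOf_eq_one]
  have hζη : ζ ∈ Subgroup.zpowers ((g : Q) ^ p ^ n) := by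
    have h1 : (g : Q) ^ (k * p) = 1 := by rw [zpow_mul, hk, zpow_natCast, hζp]
    rw [← orderOf_dvd_iff_zpow_eq_one, hn, pow_succ, Nat.cast_mul] at h1
    obtain ⟨k', rfl⟩ := (mul_dvd_mul_iff_right (by exact_mod_cast hp.1.ne_zero)).mp h1
    exact ⟨k', by simp only; rw [← hk, zpow_mul, zpow_natCast]⟩
  obtain ⟨j, hj⟩ := mem_zpowers_of_mem_zpowers_of_pow_prime_eq_one hηp hζη hζ1
  simp only at hj
  have hpj : ¬ (p : ℤ) ∣ j := by
    rintro ⟨j', rfl⟩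
    rw [zpow_mul, zpow_natCast, hζp, one_zpow] at hj
    exact hη1 hj.symm
  have hact : ∀ m : ℤ, ∀ u ∈ U, ((g.1 ^ p ^ n) ^ m) u = (z ^ (j * m)) u := by
    intro m
    have h1 : (((g ^ p ^ n) ^ m : N) : Q) = (((⟨z, hzN⟩ : N) ^ (j * m) : N) : Q) := by
      rw [QuotientGroup.mk_zpow, QuotientGroup.mk_zpow, QuotientGroup.mk_pow, ← hj, zpow_mul]
    exact mk_eq_mk_iff_pointwiseFixer.mp h1
  have hgU : ∀ m : ℤ, (g.1 ^ m) v ∈ U := fun m => hU _ (N.zpow_mem g.2 m) v hvU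
  have hpos : (0 : ℤ) < (p ^ n : ℕ) := by exact_mod_cast pow_pos hp.1.pos n
  let R : Finset V := (Finset.range (p ^ n)).image fun i => (g.1 ^ i) v
  have hgen : ∀ m : ℤ, ∃ w ∈ R, ∃ l : ℤ, (g.1 ^ m) v = (z ^ l) w := by
    intro m
    have h0 := Int.emod_nonneg m hpos.ne'
    refine ⟨(g.1 ^ (m % (p ^ n : ℕ)).toNat) v, Finset.mem_image_of_mem _ (Finset.mem_range.mpr ?_),
      j * (m / (p ^ n : ℕ)), ?_⟩
    · have := Int.emod_lt_of_pos m hpos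
      omega
    · have h1 := hact (m / (p ^ n : ℕ)) _ (hgU (m % (p ^ n : ℕ)))
      rw [← zpow_natCast, Int.toNat_of_nonneg h0, ← h1]
      conv_lhs => rw [← Int.mul_ediv_add_emod m (p ^ n : ℕ), zpow_add, zpow_mul, zpow_natCast]
      rfl
  have perm : ∀ h ∈ N, ∀ w ∈ R, ∃ w' ∈ R, ∃ l : ℤ, h w = (z ^ l) w' := by
    intro h hh w hw
    obtain ⟨i, _, rfl⟩ := Finset.mem_image.mp hw
    obtain ⟨m, hm⟩ := hγ ((⟨h, hh⟩ : N) : Q)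
    simp only at hm
    rw [← QuotientGroup.mk_zpow] at hm
    have h1 : ∀ u ∈ U, (g.1 ^ m) u = h u := mk_eq_mk_iff_pointwiseFixer.mp hm
    have h2 := h1 _ (hgU i)
    rw [zpow_natCast] at h2
    rw [← h2, ← zpow_natCast, ← LinearEquiv.mul_apply, ← zpow_add]
    exact hgen _
  have hmem : ∀ m : ℤ, (g.1 ^ m) v ∈ Submodule.span K (zpowOrbit z R) := by
    intro m
    obtain ⟨w, hw, l, hl⟩ := hgen m
    exact Submodule.subset_span ⟨w, hw, l, hl⟩
  refine ⟨Submodule.span K (zpowOrbit z R), ?_, ?_, R, rfl, perm, ?_⟩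
  · rw [Submodule.span_le]
    rintro _ ⟨w, hw, l, rfl⟩
    obtain ⟨i, _, rfl⟩ := Finset.mem_image.mp hw
    have := hgU i
    rw [zpow_natCast] at this
    exact hU _ (N.zpow_mem hzN l) _ this
  · intro h
    have := hmem 0
    rw [h, Submodule.mem_bot] at this
    exact hv0 this
  · have hdeg := natDegree_le_finrank_of_aeval_eq_zero (hirr n) (g := (g.1 : V →ₗ[K] V)) hv0 ?_
      (W := Submodule.span K (zpowOrbit z R)) ?_
    · rw [Polynomial.natDegree_cyclotomic, Nat.totient_prime_pow_succ hp.1] at hdeg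
      refine le_trans ?_ hdeg
      rw [mul_comm]
      refine Nat.mul_le_mul_right _ (Finset.card_image_le.trans ?_)
      rw [Finset.card_range]
    · rw [Polynomial.cyclotomic_prime_pow_eq_geom_sum hp.1, map_sum, LinearMap.sum_apply]
      rw [← sum_zpow_eq_zero hzp (hU z hzN) hsum hpj hvU]
      refine Finset.sum_congr rfl fun i _ => ?_
      rw [map_pow, map_pow, Polynomial.aeval_X, ← pow_mul, LinearEquiv.toLinearMap_pow, pow_mul]
      have h1 := hact i v hvU
      rw [zpow_mul, zpow_natCast, zpow_natCast] at h1
      exact h1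
    · intro i
      have h1 := hmem i
      rw [zpow_natCast] at h1
      rw [LinearEquiv.toLinearMap_pow]
      exact h1

end Cyclic

/-! ### Frames induced from the centralizer of an element of order p -/

section Noncyclic

variable {K V : Type*} [Field K] [AddCommGroup V] [Module K V]
variable {p : ℕ} [hp : Fact p.Prime]

/-- Among the elements `e * z ^ l` one has a nonzero fixed vector. -/
theorem exists_mul_pow_fixed_vector [CharZero K] {U : Submodule K V} (hU0 : U ≠ ⊥) {z e : V ≃ₗ[K] V}
    (hzp : z ^ p = 1) (hzU : ∀ u ∈ U, z u ∈ U) (heU : ∀ u ∈ U, e u ∈ U) (hze : Commute z e)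
    (hsum : ∀ u ∈ U, ∑ i ∈ Finset.range p, (z ^ i) u = 0) (hep : ∀ u ∈ U, (e ^ p) u = u) :
    ∃ l : ℕ, ∃ u ∈ U, u ≠ 0 ∧ (e * z ^ l) u = u := by
  obtain ⟨v, hvU, hv0⟩ := Submodule.exists_mem_ne_zero_of_ne_bot hU0
  have hpowU : ∀ (a : V ≃ₗ[K] V), (∀ u ∈ U, a u ∈ U) → ∀ n : ℕ, ∀ u ∈ U, (a ^ n) u ∈ U := by
    intro a ha n
    induction n with
    | zero => intro u hu; exact hu
    | succ n ih => intro u hu; rw [pow_succ]; exact ih _ (ha u hu)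
  have hezU : ∀ l : ℕ, ∀ u ∈ U, (e * z ^ l) u ∈ U := fun l u hu => heU _ (hpowU z hzU l u hu)
  have hfix : ∀ l : ℕ, (e * z ^ l) (∑ j ∈ Finset.range p, ((e * z ^ l) ^ j) v) =
      ∑ j ∈ Finset.range p, ((e * z ^ l) ^ j) v := by
    intro l
    have h1 : (e * z ^ l) (∑ j ∈ Finset.range p, ((e * z ^ l) ^ j) v) =
        ∑ j ∈ Finset.range p, ((e * z ^ l) ^ (j + 1)) v := by
      rw [map_sum]
      exact Finset.sum_congr rfl fun j _ => by rw [pow_succ']; rfl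
    have h2 := Finset.sum_range_succ' (fun j => ((e * z ^ l) ^ j) v) p
    have h3 : ((e * z ^ l) ^ p) v = v := by
      rw [(hze.pow_left l).symm.mul_pow, ← pow_mul, mul_comm l, pow_mul, hzp, one_pow, mul_one]
      exact hep v hvU
    rw [Finset.sum_range_succ, pow_zero, h3] at h2
    rw [h1]
    exact (add_right_cancel h2).symm
  by_contra! hcon
  have hzero : ∀ l : ℕ, ∑ j ∈ Finset.range p, ((e * z ^ l) ^ j) v = 0 := by
    intro l
    by_contra h
    exact hcon l _ (Submodule.sum_mem _ fun j _ => hpowU _ (hezU l) j v hvU) h (hfix l)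
  -- Exchange the two sums: for each j ≠ 0 the sum over l vanishes because it runs over the powers
  -- of z ^ j, and j = 0 leaves p • v ≠ 0. So the averages over the e * z ^ l cannot all vanish.
  have htot : ∑ l ∈ Finset.range p, ∑ j ∈ Finset.range p, ((e * z ^ l) ^ j) v = 0 :=
    Finset.sum_eq_zero fun l _ => hzero l
  rw [Finset.sum_comm, Finset.sum_eq_single 0] at htot
  · simp only [pow_zero, Finset.sum_const, Finset.card_range] at htot
    rw [← Nat.cast_smul_eq_nsmul K, smul_eq_zero] at htot
    exact htot.elim (by exact_mod_cast hp.1.ne_zero) hv0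
  · intro j hj hj0
    have hpj : ¬ (p : ℤ) ∣ j := by
      rw [Int.natCast_dvd_natCast]
      exact fun h => hj0 (Nat.eq_zero_of_dvd_of_lt h (Finset.mem_range.mp hj))
    have h1 := sum_zpow_eq_zero hzp hzU hsum hpj hvU
    have h2 : ∀ l : ℕ, ((e * z ^ l) ^ j) v = (e ^ j) (((z ^ (j : ℤ)) ^ l) v) := by
      intro l
      rw [(hze.pow_left l).symm.mul_pow, zpow_natCast, ← pow_mul, ← pow_mul, mul_comm l]
      rfl
    rw [Finset.sum_congr rfl fun l _ => h2 l, ← map_sum, h1, map_zero]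
  · exact fun h => absurd (Finset.mem_range.mpr hp.1.pos) h

/-- Distinct eigenspaces of `e` with eigenvalues powers of `z` are independent. -/
theorem injective_sum_of_twisted_fixed [CharZero K] {U : Submodule K V} {z e : V ≃ₗ[K] V}
    (hzp : z ^ p = 1) (hzU : ∀ u ∈ U, z u ∈ U) (hze : Commute z e)
    (hsum : ∀ u ∈ U, ∑ i ∈ Finset.range p, (z ^ i) u = 0) {C : Finset (Fin p)} {x : C → V}
    (hxU : ∀ k, x k ∈ U) (hx : ∀ k : C, (e * z ^ (k.1 : ℕ)) (x k) = x k) (h0 : ∑ k, x k = 0)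
    (l : C) : x l = 0 := by
  have hpowU : ∀ n : ℤ, ∀ k, (z ^ n) (x k) ∈ U := by
    intro n k
    obtain ⟨m, -, h1⟩ := exists_pow_eq_zpow hzp n
    rw [h1]
    clear h1
    induction m with
    | zero => exact hxU k
    | succ m ih => rw [pow_succ']; exact hzU _ ih
  -- On x k the element e * z ^ l acts as z ^ (l - k). Summing its powers thus kills x k for k ≠ l
  -- and multiplies x l by p.
  have hstep : ∀ (k : C) (j : ℕ), ((e * z ^ (l.1 : ℕ)) ^ j) (x k) =
      ((z ^ ((l.1 : ℕ) - (k.1 : ℕ) : ℤ)) ^ j) (x k) := by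
    intro k j
    induction j with
    | zero => rfl
    | succ j ih =>
      have hc : e * z ^ (l.1 : ℕ) = z ^ ((l.1 : ℕ) - (k.1 : ℕ) : ℤ) * (e * z ^ (k.1 : ℕ)) := by
        rw [← mul_assoc, (hze.zpow_left _).eq, mul_assoc, ← zpow_natCast, ← zpow_natCast,
          ← zpow_add, sub_add_cancel]
      have hcc : Commute (e * z ^ (l.1 : ℕ)) (z ^ ((l.1 : ℕ) - (k.1 : ℕ) : ℤ)) :=
        Commute.mul_left (hze.zpow_left _).symm ((Commute.refl z).pow_left _ |>.zpow_right _)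
      rw [pow_succ', LinearEquiv.mul_apply, ih, ← LinearEquiv.mul_apply, (hcc.pow_right j).eq,
        LinearEquiv.mul_apply]
      conv_lhs => rw [hc, LinearEquiv.mul_apply, hx k]
      rw [pow_succ, LinearEquiv.mul_apply]
  have h1 : ∑ j ∈ Finset.range p, ((e * z ^ (l.1 : ℕ)) ^ j) (∑ k, x k) = 0 := by
    rw [h0]; simp
  simp only [map_sum] at h1
  rw [Finset.sum_comm, Finset.sum_eq_single l] at h1
  · rw [Finset.sum_congr rfl fun j _ => hstep l j] at h1
    simp only [sub_self, zpow_zero, one_pow, LinearEquiv.coe_one, id_eq, Finset.sum_const,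
      Finset.card_range] at h1
    rw [← Nat.cast_smul_eq_nsmul K, smul_eq_zero] at h1
    exact h1.resolve_left (by exact_mod_cast hp.1.ne_zero)
  · intro k _ hkl
    rw [Finset.sum_congr rfl fun j _ => hstep k j]
    refine sum_zpow_eq_zero hzp hzU hsum ?_ (hxU k)
    intro hdvd
    have h2 := l.1.2
    have h3 := k.1.2
    have h4 := Int.eq_zero_of_abs_lt_dvd hdvd (by rw [abs_lt]; omega)
    exact hkl (Subtype.ext (Fin.ext (by omega)))
  · exact fun h => absurd (Finset.mem_univ l) h

/-- The centralizer of `e` modulo the pointwise fixer of `U`. -/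
def relCentralizer (N : Subgroup (V ≃ₗ[K] V)) (U : Submodule K V) [(pointwiseFixer N U).Normal]
    (e : N) : Subgroup (V ≃ₗ[K] V) :=
  ((Subgroup.centralizer {(e : N ⧸ pointwiseFixer N U)}).comap (QuotientGroup.mk' _)).map N.subtype

theorem mem_relCentralizer {N : Subgroup (V ≃ₗ[K] V)} {U : Submodule K V}
    [(pointwiseFixer N U).Normal] {e : N} (n : N) : n.1 ∈ relCentralizer N U e ↔
      (n : N ⧸ pointwiseFixer N U) * e = e * n := by
  constructor
  · rintro ⟨m, hm, hmn⟩
    obtain rfl : m = n := Subtype.ext hmn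
    exact Subgroup.mem_centralizer_singleton_iff.mp hm
  · intro h
    exact ⟨n, Subgroup.mem_centralizer_singleton_iff.mpr h, rfl⟩

theorem relCentralizer_le {N : Subgroup (V ≃ₗ[K] V)} {U : Submodule K V}
    [(pointwiseFixer N U).Normal] (e : N) : relCentralizer N U e ≤ N := by
  rintro _ ⟨m, _, rfl⟩
  exact m.2

/-- This is Clifford theory: let W be the fixed space in U of e, adjusted by a power of z so that W
≠ 0. Every conjugate of e is some e * z ^ k modulo the pointwise fixer, and the fixed spaces of
these elements are independent. The translates of W therefore form a direct sum, and a frame of W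
for the centralizer of e induces one for N. -/
theorem exists_monomialFrame_of_not_isCyclic [FiniteDimensional K V] [CharZero K]
    {N : Subgroup (V ≃ₗ[K] V)} {z : V ≃ₗ[K] V}
    (hzN : z ∈ N) (hz : ∀ g ∈ N, Commute z g) (hzp : z ^ p = 1) {U : Submodule K V} (hU0 : U ≠ ⊥)
    (hU : ∀ g ∈ N, ∀ u ∈ U, g u ∈ U)
    (hsum : ∀ u ∈ U, ∑ i ∈ Finset.range p, (z ^ i) u = 0) [hn : (pointwiseFixer N U).Normal]
    {e : N} (hep : (e : N ⧸ pointwiseFixer N U) ^ p = 1)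
    (hez : (e : N ⧸ pointwiseFixer N U) ∉
      Subgroup.zpowers ((⟨z, hzN⟩ : N) : N ⧸ pointwiseFixer N U))
    (hconj : ∀ g : N ⧸ pointwiseFixer N U,
      ∃ k : ℤ, g * e * g⁻¹ = e * ((⟨z, hzN⟩ : N) : N ⧸ pointwiseFixer N U) ^ k)
    (ih : ∀ (N' : Subgroup (V ≃ₗ[K] V)) (W : Submodule K V), N' ≤ N → z ∈ N' → W < U →
      (∀ g ∈ N', ∀ u ∈ W, g u ∈ W) → ∃ R, IsMonomialFrame p N' z W R) :
    ∃ U₁ ≤ U, U₁ ≠ ⊥ ∧ ∃ R, IsMonomialFrame p N z U₁ R := by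
  classical
  set Q := N ⧸ pointwiseFixer N U with hQ
  set ζ : Q := ((⟨z, hzN⟩ : N) : Q) with hζ
  have hζc : ∀ q : Q, Commute ζ q := by
    intro q
    obtain ⟨n, rfl⟩ := QuotientGroup.mk_surjective q
    have h1 : (⟨z, hzN⟩ : N) * n = n * ⟨z, hzN⟩ := Subtype.ext (hz n n.2).eq
    change ζ * n = n * ζ
    rw [hζ, ← QuotientGroup.mk_mul, h1, QuotientGroup.mk_mul]
  have hζp : ζ ^ p = 1 := by
    rw [hζ, ← QuotientGroup.mk_pow]
    have : (⟨z, hzN⟩ : N) ^ p = 1 := Subtype.ext hzp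
    rw [this]; rfl
  -- Replace `e` by a multiple with a nonzero fixed vector.
  obtain ⟨e, hep, hez, hconj, u₀, hu₀U, hu₀0, hu₀⟩ : ∃ e : N, (e : Q) ^ p = 1 ∧
      (e : Q) ∉ Subgroup.zpowers ζ ∧ (∀ g : Q, ∃ k : ℤ, g * e * g⁻¹ = e * ζ ^ k) ∧
      ∃ u ∈ U, u ≠ 0 ∧ e.1 u = u := by
    have hep' : ∀ u ∈ U, (e.1 ^ p) u = u := by
      have h1 : ((e ^ p : N) : Q) = ((1 : N) : Q) := by rw [QuotientGroup.mk_pow, hep]; rfl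
      exact mk_eq_mk_iff_pointwiseFixer.mp h1
    obtain ⟨l, u, hu, hu0, hfix⟩ := exists_mul_pow_fixed_vector hU0 hzp (hU z hzN) (hU e e.2)
      (hz e e.2) hsum hep'
    have hcoe : ((e * ⟨z, hzN⟩ ^ l : N) : Q) = (e : Q) * ζ ^ l := rfl
    refine ⟨e * ⟨z, hzN⟩ ^ l, ?_, ?_, ?_, u, hu, hu0, hfix⟩
    · rw [hcoe, ((hζc e).pow_left l).symm.mul_pow, hep, ← pow_mul, mul_comm l, pow_mul, hζp,
        one_pow, one_mul]
    · rw [hcoe]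
      intro h
      have := Subgroup.mul_mem _ h (Subgroup.inv_mem _ (Subgroup.npow_mem_zpowers ζ l))
      rw [mul_inv_cancel_right] at this
      exact hez this
    · intro g
      obtain ⟨k, hk⟩ := hconj g
      refine ⟨k, ?_⟩
      rw [hcoe, ← mul_assoc, mul_assoc _ (ζ ^ l), ((hζc g⁻¹).pow_left l).eq, ← mul_assoc, hk,
        mul_assoc, mul_assoc, ((Commute.refl ζ).zpow_left k |>.pow_right l).eq]
  have hconj' : ∀ g : N, ∃ k : Fin p, (g : Q) * e * (g : Q)⁻¹ = e * ζ ^ (k : ℕ) := by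
    intro g
    obtain ⟨k, hk⟩ := hconj g
    obtain ⟨i, hi, hki⟩ := exists_pow_eq_zpow hζp k
    exact ⟨⟨i, hi⟩, by rw [hk, hki]⟩
  let W : Submodule K V := U ⊓ LinearMap.ker ((e.1 : V →ₗ[K] V) - LinearMap.id)
  have hW : ∀ u, u ∈ W ↔ u ∈ U ∧ e.1 u = u := by
    intro u
    rw [Submodule.mem_inf, LinearMap.mem_ker, LinearMap.sub_apply, sub_eq_zero]
    rfl
  -- Proper because the class of e, lying outside ⟨ζ⟩, is nontrivial on U.
  have hWU : W < U := by
    refine lt_of_le_of_ne inf_le_left fun h => hez ?_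
    have h1 : (e : Q) = ((1 : N) : Q) :=
      mk_eq_mk_iff_pointwiseFixer.mpr fun u hu => ((hW u).mp (h.symm ▸ hu)).2
    rw [h1]
    exact Subgroup.one_mem _
  obtain ⟨R₁, hR₁⟩ := ih (relCentralizer N U e) W (relCentralizer_le e)
    ((mem_relCentralizer ⟨z, hzN⟩).mpr (hζc e).eq) hWU (by
      rintro g hg u hu
      obtain ⟨huU, hue⟩ := (hW u).mp hu
      have hgN := relCentralizer_le e hg
      refine (hW _).mpr ⟨hU g hgN u huU, ?_⟩
      have h1 := (mem_relCentralizer (U := U) (e := e) ⟨g, hgN⟩).mp hg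
      have h2 : g (e.1 u) = e.1 (g u) := mk_eq_mk_iff_pointwiseFixer.mp h1 u huU
      rw [← h2, hue])
  -- The exponents k for which e * ζ ^ k is a conjugate of e; the chosen conjugating elements n k
  -- represent the cosets of the relative centralizer in N.
  let C : Finset (Fin p) := Finset.univ.filter fun k => ∃ n : N, (n : Q) * e * (n : Q)⁻¹ = e * ζ ^ (k : ℕ)
  have hC : ∀ k : C, ∃ n : N, (n : Q) * e * (n : Q)⁻¹ = e * ζ ^ (k.1 : ℕ) := fun k =>
    (Finset.mem_filter.mp k.2).2
  choose n hn using hC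
  have hnW : ∀ (k : C), ∀ w ∈ W, (e.1 * z ^ (k.1 : ℕ)) ((n k).1 w) = (n k).1 w := by
    intro k w hw
    obtain ⟨hwU, hwe⟩ := (hW w).mp hw
    have h1 : ((n k * e : N) : Q) = ((e * ⟨z, hzN⟩ ^ (k.1 : ℕ) * n k : N) : Q) := by
      rw [QuotientGroup.mk_mul, mul_inv_eq_iff_eq_mul.mp (hn k)]; rfl
    have h2 : (n k).1 (e.1 w) = (e.1 * z ^ (k.1 : ℕ)) ((n k).1 w) :=
      mk_eq_mk_iff_pointwiseFixer.mp h1 w hwU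
    rw [← h2, hwe]
  let R : Finset V := Finset.univ.biUnion fun k : C => R₁.image fun w => (n k).1 w
  have hRmem : ∀ v, v ∈ R ↔ ∃ k : C, ∃ w ∈ R₁, (n k).1 w = v := by
    intro v
    simp [R]
  have hR₁U : ∀ w ∈ R₁, w ∈ U := fun w hw => hWU.le (hR₁.zpow_mem hw 0)
  have perm : ∀ g ∈ N, ∀ v ∈ R, ∃ w ∈ R, ∃ t : ℤ, g v = (z ^ t) w := by
    intro g hg v hv
    obtain ⟨k, w, hw, rfl⟩ := (hRmem v).mp hv
    obtain ⟨l, hl⟩ := hconj' (⟨g, hg⟩ * n k)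
    have hlC : l ∈ C := Finset.mem_filter.mpr ⟨Finset.mem_univ _, _, hl⟩
    set l' : C := ⟨l, hlC⟩
    -- The usual cocycle of an induced representation: g * n k and n l' conjugate e to the same
    -- element, so m centralizes e.
    set m : N := (n l')⁻¹ * (⟨g, hg⟩ * n k) with hm
    have hmc : m.1 ∈ relCentralizer N U e := by
      rw [mem_relCentralizer]
      have h1 := mul_inv_eq_iff_eq_mul.mp hl
      have h2 := mul_inv_eq_iff_eq_mul.mp (hn l')
      have h3 : (m : Q) = (n l' : Q)⁻¹ * ((⟨g, hg⟩ * n k : N) : Q) := rfl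
      have h4 : (n l' : Q)⁻¹ * (e * ζ ^ (l : ℕ)) = e * (n l' : Q)⁻¹ := by
        rw [inv_mul_eq_iff_eq_mul, ← mul_assoc, eq_mul_inv_iff_mul_eq]
        exact h2.symm
      rw [h3, mul_assoc, h1, ← mul_assoc, h4, mul_assoc]
    obtain ⟨w', hw', t, ht⟩ := hR₁.perm m hmc w hw
    refine ⟨(n l').1 w', (hRmem _).mpr ⟨l', w', hw', rfl⟩, t, ?_⟩
    have h5 : g * (n k).1 = (n l').1 * m.1 := by
      have : (⟨g, hg⟩ * n k : N) = n l' * m := by rw [hm, mul_inv_cancel_left]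
      exact congrArg Subtype.val this
    have h6 : g ((n k).1 w) = (n l').1 (m.1 w) := congrArg (fun a : V ≃ₗ[K] V => a w) h5
    rw [h6, ht, ← LinearEquiv.mul_apply, ← LinearEquiv.mul_apply,
      ((hz _ (n l').2).zpow_left t).eq]
  set U₁ := Submodule.span K (zpowOrbit z R) with hU₁
  have hnU₁ : ∀ (k : C), ∀ w ∈ W, (n k).1 w ∈ U₁ := by
    intro k w hw
    have hle : W ≤ U₁.comap ((n k).1 : V →ₗ[K] V) := by
      rw [← hR₁.span_eq, Submodule.span_le]
      rintro _ ⟨v, hv, t, rfl⟩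
      refine Submodule.subset_span ⟨(n k).1 v, (hRmem _).mpr ⟨k, v, hv, rfl⟩, t, ?_⟩
      change ((n k).1 * z ^ t) v = _
      rw [← ((hz _ (n k).2).zpow_left t).eq]
      rfl
    exact hle hw
  obtain ⟨k₀, hk₀⟩ := hconj' 1
  set k₀' : C := ⟨k₀, Finset.mem_filter.mpr ⟨Finset.mem_univ _, _, hk₀⟩⟩
  refine ⟨U₁, ?_, ?_, R, rfl, perm, ?_⟩
  · rw [hU₁, Submodule.span_le]
    rintro _ ⟨v, hv, t, rfl⟩
    obtain ⟨k, w, hw, rfl⟩ := (hRmem v).mp hv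
    exact hU _ (N.zpow_mem hzN t) _ (hU _ (n k).2 _ (hR₁U w hw))
  · intro h
    have h1 := hnU₁ k₀' u₀ ((hW _).mpr ⟨hu₀U, hu₀⟩)
    rw [h, Submodule.mem_bot, LinearEquiv.map_eq_zero_iff] at h1
    exact hu₀0 h1
  -- Injectivity of F says that the sum of the translates of W is direct, so dim U₁ ≥ |C| dim W,
  -- while |R| ≤ |C||R₁|.
  · let F : (C → W) →ₗ[K] U₁ :=
      { toFun := fun f => ⟨∑ k, (n k).1 (f k).1, Submodule.sum_mem _ fun k _ => hnU₁ k _ (f k).2⟩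
        map_add' := fun f g => Subtype.ext (by simp [Finset.sum_add_distrib])
        map_smul' := fun c f => Subtype.ext (by simp [Finset.smul_sum]) }
    have hF : Function.Injective F := by
      rw [injective_iff_map_eq_zero]
      intro f hf
      have h0 : ∑ k, (n k).1 (f k).1 = 0 := congrArg Subtype.val hf
      funext l
      have h1 := injective_sum_of_twisted_fixed hzp (hU z hzN) (hz e e.2) hsum
        (fun k => hU _ (n k).2 _ (hWU.le (f k).2)) (fun k => hnW k _ (f k).2) h0 l
      rw [LinearEquiv.map_eq_zero_iff] at h1
      exact Subtype.ext h1
    have h2 := LinearMap.finrank_le_finrank_of_injective hF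
    rw [Module.finrank_pi_fintype, Finset.sum_const, Finset.card_univ, Fintype.card_coe,
      smul_eq_mul] at h2
    have h3 : R.card ≤ C.card * R₁.card := by
      refine Finset.card_biUnion_le.trans ?_
      refine (Finset.sum_le_sum fun k _ => Finset.card_image_le).trans ?_
      rw [Finset.sum_const, Finset.card_univ, Fintype.card_coe, smul_eq_mul]
    calc (p - 1) * R.card ≤ (p - 1) * (C.card * R₁.card) := Nat.mul_le_mul_left _ h3
      _ = C.card * ((p - 1) * R₁.card) := by ring
      _ ≤ C.card * Module.finrank K W := Nat.mul_le_mul_left _ hR₁.card_le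
      _ ≤ _ := h2

end Noncyclic

/-! ### Existence of monomial frames -/

section Structure

variable {K V : Type*} [Field K] [AddCommGroup V] [Module K V] [FiniteDimensional K V] [CharZero K]
variable {p : ℕ} [hp : Fact p.Prime]

/-- Finite `p`-groups of automorphisms over a field in which the `p`-power cyclotomic polynomials
are irreducible are monomial over the `p`-th roots of unity. -/
theorem exists_monomialFrame (hodd : p ≠ 2)
    (hirr : ∀ n : ℕ, Irreducible (Polynomial.cyclotomic (p ^ (n + 1)) K)) {z : V ≃ₗ[K] V}
    (hzp : z ^ p = 1) (N : Subgroup (V ≃ₗ[K] V)) [Finite N] (hN : IsPGroup p N) (hzN : z ∈ N)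
    (hz : ∀ g ∈ N, Commute z g) (U : Submodule K V)
    (hU : ∀ g ∈ N, ∀ u ∈ U, g u ∈ U)
    (hsum : ∀ u ∈ U, ∑ i ∈ Finset.range p, (z ^ i) u = 0) :
    ∃ R, IsMonomialFrame p N z U R := by
  classical
  -- The group varies as well, because the noncyclic case passes to a centralizer acting on a
  -- smaller space.
  induction hd : Module.finrank K U using Nat.strong_induction_on generalizing N U with
  | _ d ih =>
  subst hd
  by_cases hU0 : U = ⊥
  · subst hU0
    refine ⟨∅, ?_, by simp, by simp⟩
    have : zpowOrbit z (∅ : Finset V) = ∅ := by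
      ext x; simp [zpowOrbit]
    rw [this, Submodule.span_empty]
  have hnorm := pointwiseFixer_normal hU
  obtain ⟨U₁, hU₁, hU₁0, R₁, hR₁⟩ : ∃ U₁ ≤ U, U₁ ≠ ⊥ ∧ ∃ R, IsMonomialFrame p N z U₁ R := by
    by_cases hcyc : IsCyclic (N ⧸ pointwiseFixer N U)
    · exact exists_monomialFrame_of_isCyclic hirr hN hzN hzp hU0 hU hsum hcyc
    · have hζc : ((⟨z, hzN⟩ : N) : N ⧸ pointwiseFixer N U) ∈
          Subgroup.center (N ⧸ pointwiseFixer N U) := by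
        rw [Subgroup.mem_center_iff]
        intro q
        obtain ⟨n, rfl⟩ := QuotientGroup.mk_surjective q
        have h1 : (⟨z, hzN⟩ : N) * n = n * ⟨z, hzN⟩ := Subtype.ext (hz n n.2).eq
        rw [← QuotientGroup.mk_mul, ← h1, QuotientGroup.mk_mul]
      have hζp : ((⟨z, hzN⟩ : N) : N ⧸ pointwiseFixer N U) ^ p = 1 := by
        rw [← QuotientGroup.mk_pow]
        have : (⟨z, hzN⟩ : N) ^ p = 1 := Subtype.ext hzp
        rw [this]; rfl
      have hζ1 : ((⟨z, hzN⟩ : N) : N ⧸ pointwiseFixer N U) ≠ 1 := by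
        intro h
        obtain ⟨v, hvU, hv0⟩ := Submodule.exists_mem_ne_zero_of_ne_bot hU0
        have h1 : ∀ u ∈ U, z u = u := mk_eq_mk_iff_pointwiseFixer.mp h
        have h2 : ∀ i : ℕ, (z ^ i) v = v := by
          intro i
          induction i with
          | zero => rfl
          | succ i ih => rw [pow_succ, LinearEquiv.mul_apply, h1 v hvU, ih]
        have h3 := hsum v hvU
        rw [Finset.sum_congr rfl fun i _ => h2 i, Finset.sum_const, Finset.card_range,
          ← Nat.cast_smul_eq_nsmul K, smul_eq_zero] at h3
        exact h3.elim (by exact_mod_cast hp.1.ne_zero) hv0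
      obtain ⟨e, hep, hez, hconj⟩ :=
        (hN.to_quotient (pointwiseFixer N U)).exists_pow_prime_eq_one_and_commutator_mem_zpowers
          hodd hcyc hζc hζp hζ1
      obtain ⟨e, rfl⟩ := QuotientGroup.mk_surjective e
      refine exists_monomialFrame_of_not_isCyclic hzN hz hzp hU0 hU hsum hep hez hconj ?_
      intro N' W hN' hzN' hW hWinv
      have : Finite N' := Finite.of_injective _ (Subgroup.inclusion_injective hN')
      exact ih _ (Submodule.finrank_lt_finrank_of_lt hW) N' (hN.to_le hN') hzN'
        (fun g hg => hz g (hN' hg)) W hWinv (fun u hu => hsum u (hW.le hu)) rfl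
  have hU₁inv : ∀ g ∈ N, ∀ u ∈ U₁, g u ∈ U₁ := by
    have h := span_zpowOrbit_invariant hz hR₁.perm
    rwa [hR₁.span_eq] at h
  obtain ⟨U₂, hU₂, hU₂inv, hd, hsup⟩ := exists_invariant_complement N hU hU₁inv hU₁
  have hlt : Module.finrank K U₂ < Module.finrank K U := by
    have h := Submodule.finrank_sup_add_finrank_inf_eq U₁ U₂
    rw [hd.eq_bot, finrank_bot, add_zero, hsup] at h
    have h1 : Module.finrank K U₁ ≠ 0 := fun h0 => hU₁0 (Submodule.finrank_eq_zero.mp h0)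
    omega
  obtain ⟨R₂, hR₂⟩ := ih _ hlt N hN hzN hz U₂ hU₂inv (fun u hu => hsum u (hU₂ hu)) rfl
  exact ⟨R₁ ∪ R₂, hsup ▸ hR₁.sup hR₂ hd⟩

end Structure

/-! ### A commuting automorphism of order dividing p with small fixed space -/

section CentralElement

variable {K V : Type*} [Field K] [AddCommGroup V] [Module K V]

/-- The fixed space of an automorphism. -/
def fixedSpace (s : V ≃ₗ[K] V) : Submodule K V := LinearMap.ker ((s : V →ₗ[K] V) - LinearMap.id)

theorem mem_fixedSpace {s : V ≃ₗ[K] V} {v : V} : v ∈ fixedSpace s ↔ s v = v := by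
  rw [fixedSpace, LinearMap.mem_ker, LinearMap.sub_apply, sub_eq_zero]
  rfl

/-- The projection `p⁻¹ (1 + s + ⋯ + s ^ (p - 1))`. -/
noncomputable def averageMap (p : ℕ) (s : V ≃ₗ[K] V) : V →ₗ[K] V :=
  (p : K)⁻¹ • ∑ i ∈ Finset.range p, ((s ^ i : V ≃ₗ[K] V) : V →ₗ[K] V)

variable {p : ℕ}

theorem averageMap_apply (s : V ≃ₗ[K] V) (v : V) :
    averageMap p s v = (p : K)⁻¹ • ∑ i ∈ Finset.range p, (s ^ i) v := by
  simp [averageMap]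

theorem averageMap_mem {s : V ≃ₗ[K] V} (hs : s ^ p = 1) (v : V) : averageMap p s v ∈ fixedSpace s := by
  rw [mem_fixedSpace, averageMap_apply, map_smul, map_sum]
  congr 1
  have h2 := Finset.sum_range_succ' (fun j => (s ^ j) v) p
  rw [Finset.sum_range_succ, pow_zero, hs] at h2
  rw [add_right_cancel h2]
  exact Finset.sum_congr rfl fun j _ => by rw [pow_succ']; rfl

theorem averageMap_commute {s h : V ≃ₗ[K] V} (hsh : Commute s h) (v : V) :
    averageMap p s (h v) = h (averageMap p s v) := by
  rw [averageMap_apply, averageMap_apply, map_smul, map_sum]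
  congr 1
  refine Finset.sum_congr rfl fun i _ => ?_
  rw [← LinearEquiv.mul_apply, (hsh.pow_left i).eq, LinearEquiv.mul_apply]

variable [CharZero K] [hp : Fact p.Prime]

theorem averageMap_eq_self {s : V ≃ₗ[K] V} {v : V} (hv : v ∈ fixedSpace s) :
    averageMap p s v = v := by
  rw [mem_fixedSpace] at hv
  have h2 : ∀ i : ℕ, (s ^ i) v = v := by
    intro i
    induction i with
    | zero => rfl
    | succ i ih => rw [pow_succ, LinearEquiv.mul_apply, hv, ih]
  rw [averageMap_apply, Finset.sum_congr rfl fun i _ => h2 i, Finset.sum_const, Finset.card_range,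
    ← Nat.cast_smul_eq_nsmul K, smul_smul, inv_mul_cancel₀ (by exact_mod_cast hp.1.ne_zero), one_smul]

/-- Modify `s` on its fixed space by an endomorphism `t` of order `p` there. -/
theorem exists_fixedSpace_eq_inf {s : V ≃ₗ[K] V} (hs : s ^ p = 1) {H : Subgroup (V ≃ₗ[K] V)}
    (hsH : ∀ h ∈ H, Commute s h) (t : V →ₗ[K] V) (htW : ∀ w ∈ fixedSpace s, t w ∈ fixedSpace s)
    (htp : ∀ w ∈ fixedSpace s, (t ^ p) w = w)
    (htH : ∀ h ∈ H, ∀ w ∈ fixedSpace s, h (t w) = t (h w)) :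
    ∃ s' : V ≃ₗ[K] V, s' ^ p = 1 ∧ (∀ h ∈ H, Commute s' h) ∧
      ∀ v, v ∈ fixedSpace s' ↔ v ∈ fixedSpace s ∧ t v = v := by
  set π := averageMap p s with hπ
  have hπm : ∀ v, π v ∈ fixedSpace s := fun v => averageMap_mem hs v
  have hπt : ∀ v, π (t (π v)) = t (π v) := fun v => averageMap_eq_self (htW _ (hπm v))
  have hππ : ∀ v, π (π v) = π v := fun v => averageMap_eq_self (hπm v)
  have hπs : ∀ v, π (s v) = π v := fun v => by
    rw [hπ, averageMap_commute (Commute.refl s)]; exact mem_fixedSpace.mp (hπm v)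
  have hsπ : ∀ v, s (π v) = π v := fun v => mem_fixedSpace.mp (hπm v)
  -- Since s ∘ π = π, this is t on the fixed space of s and s on the complementary kernel of π.
  let T : V →ₗ[K] V := t ∘ₗ π + (s : V →ₗ[K] V) - π
  have hT : ∀ v, T v = t (π v) + s v - π v := fun v => rfl
  have htk : ∀ (k : ℕ) v, (t ^ k) (π v) ∈ fixedSpace s := by
    intro k v
    induction k with
    | zero => exact hπm v
    | succ k ih => rw [pow_succ']; exact htW _ ih
  have hTk : ∀ (k : ℕ) v, (T ^ k) v = (t ^ k) (π v) + (s ^ k) v - π v := by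
    intro k v
    induction k with
    | zero => simp
    | succ k ih =>
      have h1 : π ((s ^ k) v) = π v := by
        clear ih
        induction k with
        | zero => rfl
        | succ k ih => rw [pow_succ', LinearEquiv.mul_apply, hπs, ih]
      have h2 : π ((t ^ k) (π v)) = (t ^ k) (π v) := averageMap_eq_self (htk k v)
      have h3 : s ((t ^ k) (π v)) = (t ^ k) (π v) := mem_fixedSpace.mp (htk k v)
      rw [pow_succ', Module.End.mul_apply, ih, hT]
      simp only [map_add, map_sub, h1, h2, h3, hππ, hsπ]
      rw [pow_succ' t, pow_succ' s, Module.End.mul_apply, LinearEquiv.mul_apply]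
      abel
  have hTp : T ^ p = 1 := by
    ext v
    rw [hTk, htp _ (hπm v), hs]
    simp
  have hpp : p - 1 + 1 = p := Nat.sub_add_cancel hp.1.pos
  let s' : V ≃ₗ[K] V := LinearEquiv.ofLinearMap T (T ^ (p - 1))
    (by rw [← Module.End.mul_eq_comp, ← pow_succ', hpp, hTp]; rfl)
    (by rw [← Module.End.mul_eq_comp, ← pow_succ, hpp, hTp]; rfl)
  have hs' : ∀ v, s' v = T v := fun v => rfl
  refine ⟨s', ?_, ?_, ?_⟩
  · apply LinearEquiv.toLinearMap_injective
    rw [← LinearEquiv.toLinearMap_pow]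
    exact hTp
  · intro h hh
    apply LinearEquiv.ext
    intro v
    rw [LinearEquiv.mul_apply, LinearEquiv.mul_apply, hs', hs', hT, hT, map_sub, map_add,
      htH h hh _ (hπm v), hπ, averageMap_commute (hsH h hh), ← LinearEquiv.mul_apply s h,
      (hsH h hh).eq, LinearEquiv.mul_apply]
  · intro v
    rw [mem_fixedSpace, hs', hT]
    constructor
    · intro hv
      have h1 : t (π v) = π v := by
        have := congrArg π hv
        rwa [map_sub, map_add, hπt, hπs, hππ, add_sub_cancel_right] at this
      rw [h1, add_sub_cancel_left] at hv
      have h2 : v ∈ fixedSpace s := mem_fixedSpace.mpr hv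
      have h3 : π v = v := averageMap_eq_self h2
      rw [h3] at h1
      exact ⟨h2, h1⟩
    · rintro ⟨hv, htv⟩
      have h3 : π v = v := averageMap_eq_self hv
      rw [h3, htv, mem_fixedSpace.mp hv, add_sub_cancel_left]

/-- The field K[X]/(Φ_p) has dimension p - 1 and multiplication by the root has order p. Embed it as
a direct summand of W and act trivially on the rest; the root is not 1 because Φ_p(1) = p ≠ 0. -/
theorem exists_pow_prime_eq_one_of_le_finrank
    (hirr : Irreducible (Polynomial.cyclotomic p K)) (W : Type*) [AddCommGroup W] [Module K W]
    [FiniteDimensional K W] (hW : p - 1 ≤ Module.finrank K W) :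
    ∃ τ : Module.End K W, τ ^ p = 1 ∧ τ ≠ 1 := by
  have : Fact (Irreducible (Polynomial.cyclotomic p K)) := ⟨hirr⟩
  set Φ := Polynomial.cyclotomic p K with hΦ
  have : Module.Finite K (AdjoinRoot Φ) := (AdjoinRoot.powerBasis hirr.ne_zero).finite
  have hfin : Module.finrank K (AdjoinRoot Φ) = p - 1 := by
    rw [(AdjoinRoot.powerBasis hirr.ne_zero).finrank, AdjoinRoot.powerBasis_dim,
      Polynomial.natDegree_cyclotomic, Nat.totient_prime hp.1]
  have e : W ≃ₗ[K] AdjoinRoot Φ × (Fin (Module.finrank K W - (p - 1)) → K) := by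
    refine LinearEquiv.ofFinrankEq _ _ ?_
    rw [Module.finrank_prod, hfin, Module.finrank_fin_fun]
    omega
  have hroot : (AdjoinRoot.root Φ) ^ p = 1 := by
    have h1 : Φ ∣ Polynomial.X ^ p - 1 := Polynomial.cyclotomic.dvd_X_pow_sub_one p K
    have h2 := AdjoinRoot.mk_eq_zero.mpr h1
    rw [map_sub, map_pow, AdjoinRoot.mk_X, map_one, sub_eq_zero] at h2
    exact h2
  have hroot1 : AdjoinRoot.root Φ ≠ 1 := by
    intro h
    have h1 : Polynomial.eval₂ (AdjoinRoot.of Φ) (AdjoinRoot.root Φ) Φ = 0 :=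
      AdjoinRoot.eval₂_root Φ
    have h0 : Polynomial.eval 1 Φ = (p : K) := Polynomial.eval_one_cyclotomic_prime
    rw [h, Polynomial.eval₂_at_one, h0, map_natCast] at h1
    have : CharZero (AdjoinRoot Φ) := charZero_of_injective_algebraMap (algebraMap K _).injective
    exact hp.1.ne_zero (by exact_mod_cast h1)
  let μ : Module.End K (AdjoinRoot Φ) := LinearMap.mulLeft K (AdjoinRoot.root Φ)
  let τ : Module.End K (AdjoinRoot Φ × (Fin (Module.finrank K W - (p - 1)) → K)) :=
    LinearMap.prodMap μ LinearMap.id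
  have hτ : ∀ (k : ℕ) x, (τ ^ k) x = ((AdjoinRoot.root Φ) ^ k * x.1, x.2) := by
    intro k x
    induction k with
    | zero => simp
    | succ k ih =>
      rw [pow_succ', Module.End.mul_apply, ih, pow_succ', mul_assoc]
      rfl
  refine ⟨e.symm.conjRingEquiv τ, ?_, ?_⟩
  · rw [← map_pow]
    have : τ ^ p = 1 := LinearMap.ext fun x => by rw [hτ, hroot, one_mul]; rfl
    rw [this, map_one]
  · intro h
    rw [map_eq_one_iff _ (RingEquiv.injective _)] at h
    have h1 := hτ 1 (1, 0)
    rw [pow_one, h] at h1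
    have h2 := congrArg Prod.fst h1
    rw [pow_one, mul_one] at h2
    exact hroot1 h2.symm

end CentralElement

section CentralElement

variable {K V : Type*} [Field K] [AddCommGroup V] [Module K V] [FiniteDimensional K V] [CharZero K]
variable {p : ℕ} [hp : Fact p.Prime]

/-- A finite `p`-group `H` of automorphisms commutes with an automorphism of order dividing `p` whose
fixed space has dimension less than `p - 1` and is fixed by `H`. -/
theorem exists_commuting_automorphism (hirr : Irreducible (Polynomial.cyclotomic p K))
    (H : Subgroup (V ≃ₗ[K] V)) [Finite H] (hH : IsPGroup p H) :
    ∃ s : V ≃ₗ[K] V, s ^ p = 1 ∧ (∀ h ∈ H, Commute s h) ∧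
      (∀ v ∈ fixedSpace s, ∀ h ∈ H, h v = v) ∧ Module.finrank K (fixedSpace s) < p - 1 := by
  obtain ⟨s, ⟨hs, hsH⟩, hmin⟩ := WellFounded.has_min
    (measure fun s : V ≃ₗ[K] V => Module.finrank K (fixedSpace s)).wf
    {s : V ≃ₗ[K] V | s ^ p = 1 ∧ ∀ h ∈ H, Commute s h}
    ⟨1, one_pow p, fun h _ => Commute.one_left h⟩
  -- Minimality of the fixed space: a nontrivial t of this kind could be glued to s and would shrink
  -- it.
  have himp : ∀ t : V →ₗ[K] V, (∀ w ∈ fixedSpace s, t w ∈ fixedSpace s) →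
      (∀ w ∈ fixedSpace s, (t ^ p) w = w) →
      (∀ h ∈ H, ∀ w ∈ fixedSpace s, h (t w) = t (h w)) → ∀ w ∈ fixedSpace s, t w = w := by
    intro t htW htp htH w hw
    by_contra hne
    obtain ⟨s', hs', hs'H, hfix⟩ := exists_fixedSpace_eq_inf hs hsH t htW htp htH
    refine hmin s' ⟨hs', hs'H⟩ (Submodule.finrank_lt_finrank_of_lt ?_)
    refine lt_of_le_of_ne (fun v hv => ((hfix v).mp hv).1) fun heq => hne ?_
    rw [← heq] at hw
    exact ((hfix w).mp hw).2
  have hinv : ∀ h ∈ H, ∀ w ∈ fixedSpace s, h w ∈ fixedSpace s := by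
    intro h hh w hw
    rw [mem_fixedSpace] at hw ⊢
    rw [← LinearEquiv.mul_apply, (hsH h hh).eq, LinearEquiv.mul_apply, hw]
  -- Otherwise a central element of order p in the image of H on the fixed space would be such a t.
  have htriv : ∀ v ∈ fixedSpace s, ∀ h ∈ H, h v = v := by
    have hn := pointwiseFixer_normal hinv
    by_cases hQ : Nontrivial (H ⧸ pointwiseFixer H (fixedSpace s))
    · obtain ⟨t, htc, htp, ht1⟩ :=
        (hH.to_quotient (pointwiseFixer H (fixedSpace s))).exists_mem_center_pow_prime_eq_one
      obtain ⟨t, rfl⟩ := QuotientGroup.mk_surjective t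
      refine absurd (mk_eq_mk_iff_pointwiseFixer (b := 1).mpr ?_) ht1
      refine himp (t.1 : V →ₗ[K] V) (hinv t t.2) ?_ ?_
      · intro w hw
        rw [LinearEquiv.toLinearMap_pow]
        have h1 : ((t ^ p : H) : H ⧸ pointwiseFixer H (fixedSpace s)) = (1 : H) := by
          rw [QuotientGroup.mk_pow, htp]; rfl
        exact mk_eq_mk_iff_pointwiseFixer.mp h1 w hw
      · intro h hh w hw
        have h1 : ((⟨h, hh⟩ * t : H) : H ⧸ pointwiseFixer H (fixedSpace s)) =
            (t * ⟨h, hh⟩ : H) := Subgroup.mem_center_iff.mp htc ((⟨h, hh⟩ : H) : H ⧸ pointwiseFixer H (fixedSpace s))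
        exact mk_eq_mk_iff_pointwiseFixer.mp h1 w hw
    · rw [not_nontrivial_iff_subsingleton] at hQ
      intro v hv h hh
      have h1 : ((⟨h, hh⟩ : H) : H ⧸ pointwiseFixer H (fixedSpace s)) = (1 : H) :=
        Subsingleton.elim _ _
      exact mk_eq_mk_iff_pointwiseFixer.mp h1 v hv
  refine ⟨s, hs, hsH, htriv, ?_⟩
  -- Because H is trivial on the fixed space, every automorphism of order p there commutes with H,
  -- and one exists once the dimension reaches p - 1.
  by_contra! hle
  obtain ⟨τ, hτ, hτ1⟩ := exists_pow_prime_eq_one_of_le_finrank hirr (fixedSpace s) hle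
  let π : V →ₗ[K] fixedSpace s := (averageMap p s).codRestrict _ (averageMap_mem hs)
  have hπ : ∀ w : fixedSpace s, π w.1 = w := fun w => Subtype.ext (averageMap_eq_self w.2)
  let t : V →ₗ[K] V := (fixedSpace s).subtype ∘ₗ τ ∘ₗ π
  have ht : ∀ w : fixedSpace s, t w.1 = (τ w).1 := fun w => by
    change (τ (π w.1)).1 = _
    rw [hπ]
  refine hτ1 (LinearMap.ext fun w => Subtype.ext ?_)
  rw [← ht]
  refine himp t (fun v hv => (τ _).2) ?_ ?_ w.1 w.2
  · intro v hv
    have htk : ∀ k : ℕ, (t ^ k) v = ((τ ^ k) ⟨v, hv⟩).1 := by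
      intro k
      induction k with
      | zero => rfl
      | succ k ih => rw [pow_succ', Module.End.mul_apply, ih, ht, pow_succ']; rfl
    rw [htk, hτ]; rfl
  · intro h hh v hv
    rw [htriv v hv h hh]
    exact htriv _ (τ _).2 h hh

end CentralElement

/-! ### Enlarging finite `p`-subgroups -/

open scoped Pointwise in
theorem Subgroup.finite_sup_of_le_normalizer {G : Type*} [Group G] {H N : Subgroup G} [Finite H]
    [Finite N] (h : H ≤ Subgroup.normalizer (N : Set G)) : Finite (H ⊔ N : Subgroup G) := by
  have h1 := Subgroup.coe_mul_of_left_le_normalizer_right H N h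
  have h2 : ((H ⊔ N : Subgroup G) : Set G).Finite := by
    rw [h1]
    exact Set.Finite.mul (Set.toFinite _) (Set.toFinite _)
  exact h2.to_subtype

theorem isPGroup_zpowers_of_pow_eq_one {p : ℕ} {G : Type*} [Group G] {s : G} (hs : s ^ p = 1) :
    IsPGroup p (Subgroup.zpowers s) := by
  rw [isPGroup_iff_pow_pow_eq_one]
  rintro ⟨_, k, rfl⟩
  refine ⟨1, Subtype.ext ?_⟩
  change (s ^ k) ^ p ^ 1 = 1
  rw [pow_one, ← zpow_natCast, ← zpow_mul, mul_comm, zpow_mul, zpow_natCast, hs, one_zpow]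

/-- Adjoining a commuting element of order dividing `p` to a finite `p`-group. -/
theorem finite_isPGroup_sup_zpowers {p : ℕ} [hp : Fact p.Prime] {G : Type*} [Group G]
    {H : Subgroup G} [Finite H] (hH : IsPGroup p H) {s : G} (hs : s ^ p = 1)
    (hsH : ∀ h ∈ H, Commute s h) : Finite (H ⊔ Subgroup.zpowers s : Subgroup G) ∧
      IsPGroup p (H ⊔ Subgroup.zpowers s : Subgroup G) := by
  have hfin : Finite (Subgroup.zpowers s) :=
    (finite_zpowers.mpr (isOfFinOrder_iff_pow_eq_one.mpr ⟨p, hp.1.pos, hs⟩)).to_subtype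
  have hle : H ≤ Subgroup.normalizer (Subgroup.zpowers s : Set G) := by
    rw [Subgroup.le_normalizer_iff]
    rintro h hh _ ⟨k, rfl⟩
    refine ⟨k, ?_⟩
    simp only
    rw [← ((hsH h hh).zpow_left k).eq, mul_inv_cancel_right]
  exact ⟨Subgroup.finite_sup_of_le_normalizer hle,
    hH.to_sup_of_normal_right' (isPGroup_zpowers_of_pow_eq_one hs) hle⟩

/-! ### The splitting of V by an automorphism of order dividing p -/

section Decomposition

variable {K V : Type*} [Field K] [AddCommGroup V] [Module K V] {p : ℕ}

/-- The sum of the nontrivial isotypic parts of an automorphism of order dividing `p`. -/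
def movedSpace (p : ℕ) (s : V ≃ₗ[K] V) : Submodule K V :=
  LinearMap.ker (∑ i ∈ Finset.range p, ((s ^ i : V ≃ₗ[K] V) : V →ₗ[K] V))

theorem mem_movedSpace {s : V ≃ₗ[K] V} {v : V} :
    v ∈ movedSpace p s ↔ ∑ i ∈ Finset.range p, (s ^ i) v = 0 := by
  rw [movedSpace, LinearMap.mem_ker, LinearMap.sum_apply]
  rfl

theorem movedSpace_invariant {s h : V ≃ₗ[K] V} (hsh : Commute s h) :
    ∀ u ∈ movedSpace p s, h u ∈ movedSpace p s := by
  intro u hu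
  rw [mem_movedSpace] at hu ⊢
  have h1 : ∀ i ∈ Finset.range p, (s ^ i) (h u) = h ((s ^ i) u) := fun i _ => by
    rw [← LinearEquiv.mul_apply, (hsh.pow_left i).eq, LinearEquiv.mul_apply]
  rw [Finset.sum_congr rfl h1, ← map_sum, hu, map_zero]

theorem averageMap_eq_zero {s : V ≃ₗ[K] V} {v : V} (hv : v ∈ movedSpace p s) :
    averageMap p s v = 0 := by
  rw [averageMap_apply, mem_movedSpace.mp hv, smul_zero]

variable [CharZero K] [hp : Fact p.Prime]

theorem sub_averageMap_mem_movedSpace {s : V ≃ₗ[K] V} (hs : s ^ p = 1) (v : V) :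
    v - averageMap p s v ∈ movedSpace p s := by
  have h1 := averageMap_eq_self (p := p) (averageMap_mem hs v)
  have h2 : averageMap p s (v - averageMap p s v) = 0 := by rw [map_sub, h1, sub_self]
  rw [averageMap_apply, smul_eq_zero] at h2
  exact mem_movedSpace.mpr (h2.resolve_left (inv_ne_zero (by exact_mod_cast hp.1.ne_zero)))

theorem fixedSpace_sup_movedSpace {s : V ≃ₗ[K] V} (hs : s ^ p = 1) :
    fixedSpace s ⊔ movedSpace p s = ⊤ := by
  rw [eq_top_iff]
  intro v _
  rw [← add_sub_cancel (averageMap p s v) v]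
  exact Submodule.add_mem_sup (averageMap_mem hs v) (sub_averageMap_mem_movedSpace hs v)

theorem finrank_fixedSpace_add_finrank_movedSpace [FiniteDimensional K V] {s : V ≃ₗ[K] V}
    (hs : s ^ p = 1) : Module.finrank K (fixedSpace s) + Module.finrank K (movedSpace p s) =
      Module.finrank K V := by
  have hd : Disjoint (fixedSpace s) (movedSpace p s) := by
    rw [Submodule.disjoint_def]
    intro x hx hx'
    rw [← averageMap_eq_self (p := p) hx, averageMap_eq_zero hx']
  have h := Submodule.finrank_sup_add_finrank_inf_eq (fixedSpace s) (movedSpace p s)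
  rw [hd.eq_bot, finrank_bot, add_zero, fixedSpace_sup_movedSpace hs, finrank_top] at h
  exact h.symm

/-- Automorphisms are determined on the fixed space of `s` and the orbits of a frame. -/
theorem linearMap_ext_of_frame {s : V ≃ₗ[K] V} (hs : s ^ p = 1) {R : Finset V}
    (hspan : Submodule.span K (zpowOrbit s R) = movedSpace p s) {a b : V →ₗ[K] V}
    (hfix : ∀ w ∈ fixedSpace s, a w = b w)
    (hR : ∀ v ∈ R, ∀ k : ℤ, a ((s ^ k) v) = b ((s ^ k) v)) : a = b := by
  have hle : fixedSpace s ⊔ movedSpace p s ≤ LinearMap.eqLocus a b := by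
    rw [sup_le_iff]
    refine ⟨hfix, ?_⟩
    rw [← hspan, Submodule.span_le]
    rintro _ ⟨v, hv, k, rfl⟩
    exact hR v hv k
  rw [fixedSpace_sup_movedSpace hs] at hle
  exact LinearMap.ext fun v => hle (Submodule.mem_top (x := v))

end Decomposition

/-! ### The upper bound for the number of generators -/

section Upper

universe u

variable {K : Type*} {V : Type u} [Field K] [AddCommGroup V] [Module K V] [FiniteDimensional K V]
  [CharZero K] {p : ℕ} [hp : Fact p.Prime]

/-- A finite `p`-group of automorphisms of `V` is generated by `dim V / (p - 1)` elements. -/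
theorem exists_finset_closure_eq_top_of_automorphisms (hodd : p ≠ 2)
    (hirr : ∀ n : ℕ, Irreducible (Polynomial.cyclotomic (p ^ (n + 1)) K))
    {K' : Type u} [Group K'] (ρ : K' →* (V ≃ₗ[K] V)) (hρ : Function.Injective ρ) [Finite K']
    (hK' : IsPGroup p K') :
    ∃ S : Finset K', Subgroup.closure (S : Set K') = ⊤ ∧
      (p - 1) * S.card ≤ Module.finrank K V := by
  classical
  set H := ρ.range
  have : Finite H := Finite.of_surjective _ ρ.rangeRestrict_surjective
  have hH : IsPGroup p H := hK'.of_surjective _ ρ.rangeRestrict_surjective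
  have hirr0 : Irreducible (Polynomial.cyclotomic p K) := by simpa using hirr 0
  obtain ⟨s, hs, hsH, hfix, _⟩ := exists_commuting_automorphism hirr0 H hH
  obtain ⟨hNf, hNp⟩ := finite_isPGroup_sup_zpowers hH hs hsH
  have hHN : H ≤ H ⊔ Subgroup.zpowers s := le_sup_left
  have hsN : s ∈ H ⊔ Subgroup.zpowers s :=
    (le_sup_right : Subgroup.zpowers s ≤ _) (Subgroup.mem_zpowers s)
  have hscomm : ∀ g ∈ H ⊔ Subgroup.zpowers s, Commute s g := by
    have hle : H ⊔ Subgroup.zpowers s ≤ Subgroup.centralizer {s} := by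
      rw [sup_le_iff, Subgroup.zpowers_le]
      exact ⟨fun h hh => Subgroup.mem_centralizer_singleton_iff.mpr (hsH h hh).symm,
        Subgroup.mem_centralizer_singleton_iff.mpr rfl⟩
    exact fun g hg => (Subgroup.mem_centralizer_singleton_iff.mp (hle hg)).symm
  obtain ⟨R, hR⟩ := exists_monomialFrame hodd hirr hs _ hNp hsN hscomm (movedSpace p s)
    (fun g hg => movedSpace_invariant (hscomm g hg)) (fun u hu => mem_movedSpace.mp hu)
  let _ : MulAction K' V := MulAction.compHom V ρ
  have hact : ∀ (g : K') (v : V), g • v = ρ g v := fun _ _ => rfl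
  -- The permutation representation: the translates s ^ k v number at most p|R| and are permuted
  -- because s commutes with the group.
  let J : SubMulAction K' V := ⟨zpowOrbit s R, by
    rintro g _ ⟨v, hv, k, rfl⟩
    obtain ⟨w, hw, l, hl⟩ := hR.perm (ρ g) (hHN ⟨g, rfl⟩) v hv
    refine ⟨w, hw, k + l, ?_⟩
    change (ρ g * s ^ k) v = _
    rw [← ((hsH _ ⟨g, rfl⟩).zpow_left k).eq, LinearEquiv.mul_apply, hl, zpow_add]
    rfl⟩
  let J' : Finset V := (R ×ˢ Finset.range p).image fun x => (s ^ x.2) x.1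
  have hJJ' : (J : Set V) ⊆ J' := by
    rintro _ ⟨v, hv, k, rfl⟩
    obtain ⟨i, hi, hk⟩ := exists_pow_eq_zpow hs k
    rw [hk]
    exact Finset.mem_coe.mpr (Finset.mem_image.mpr
      ⟨(v, i), Finset.mem_product.mpr ⟨hv, Finset.mem_range.mpr hi⟩, rfl⟩)
  have hJfin : Finite J := (J'.finite_toSet.subset hJJ').to_subtype
  have hJcard : Nat.card J ≤ p * R.card := by
    have h1 : Nat.card J ≤ J'.card := by
      rw [← Set.ncard_coe_finset J']
      exact Set.ncard_le_ncard hJJ' J'.finite_toSet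
    refine h1.trans (Finset.card_image_le.trans ?_)
    rw [Finset.card_product, Finset.card_range, mul_comm]
  -- Faithful because the group already fixes the fixed space of s pointwise and J spans the
  -- complement.
  have hfaith : FaithfulSMul K' J := ⟨by
    intro a b hab
    apply hρ
    apply LinearEquiv.toLinearMap_injective
    refine linearMap_ext_of_frame hs hR.span_eq ?_ ?_
    · intro w hw
      exact (hfix w hw (ρ a) ⟨a, rfl⟩).trans (hfix w hw (ρ b) ⟨b, rfl⟩).symm
    · intro v hv k
      exact congrArg Subtype.val (hab ⟨(s ^ k) v, v, hv, k, rfl⟩)⟩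
  have h1 : p * homRank p K' ≤ Nat.card J := hK'.mul_homRank_le_card
  obtain ⟨S, hS, hScard⟩ := hK'.exists_finset_closure_eq_top
  have h2 : homRank p K' ≤ R.card := Nat.le_of_mul_le_mul_left (h1.trans hJcard) hp.1.pos
  refine ⟨S, hS, (Nat.mul_le_mul_left _ (hScard.trans h2)).trans ?_⟩
  exact hR.card_le.trans (Submodule.finrank_le _)

end Upper

/-! ### The diagonal subgroup of a frame and the lower bound -/

section Lower

variable {K V : Type*} [Field K] [AddCommGroup V] [Module K V] {p : ℕ} [hp : Fact p.Prime]

theorem frame_pow_pred_apply {s : V ≃ₗ[K] V} {v : V} (hv : v ∈ movedSpace p s) :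
    (s ^ (p - 1)) v = - ∑ i ∈ Finset.range (p - 1), (s ^ i) v := by
  have h1 := mem_movedSpace.mp hv
  have hpp : p = p - 1 + 1 := (Nat.sub_add_cancel hp.1.pos).symm
  rw [hpp, Finset.sum_range_succ] at h1
  exact eq_neg_of_add_eq_zero_right h1

theorem mem_movedSpace_of_span_eq {p : ℕ} {s : V ≃ₗ[K] V} {R : Finset V}
    (hspan : Submodule.span K (zpowOrbit s R) = movedSpace p s) (v : R) (k : ℤ) :
    (s ^ k) v.1 ∈ movedSpace p s := by
  rw [← hspan]; exact Submodule.subset_span ⟨v.1, v.2, k, rfl⟩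

/-- The relation 1 + s + ⋯ + s ^ (p - 1) = 0 makes the last translate of each vector redundant. -/
theorem movedSpace_le_span_range {s : V ≃ₗ[K] V} (hs : s ^ p = 1) {R : Finset V}
    (hspan : Submodule.span K (zpowOrbit s R) = movedSpace p s) :
    movedSpace p s ≤
      Submodule.span K (Set.range fun x : R × Fin (p - 1) => (s ^ (x.2 : ℕ)) x.1.1) := by
  conv_lhs => rw [← hspan]
  rw [Submodule.span_le]
  rintro _ ⟨v, hv, k, rfl⟩
  obtain ⟨i, hi, hk⟩ := exists_pow_eq_zpow hs k
  have hlow : ∀ i < p - 1, (s ^ i) v ∈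
      Submodule.span K (Set.range fun x : R × Fin (p - 1) => (s ^ (x.2 : ℕ)) x.1.1) := fun i hi =>
    Submodule.subset_span ⟨(⟨v, hv⟩, ⟨i, hi⟩), rfl⟩
  rw [hk]
  rcases Nat.lt_or_ge i (p - 1) with h | h
  · exact hlow i h
  · obtain rfl : i = p - 1 := by omega
    have hmem : v ∈ movedSpace p s := mem_movedSpace_of_span_eq hspan ⟨v, hv⟩ 0
    rw [SetLike.mem_coe, frame_pow_pred_apply hmem]
    exact Submodule.neg_mem _ (Submodule.sum_mem _ fun i hi => hlow i (Finset.mem_range.mp hi))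

theorem finrank_movedSpace_le {s : V ≃ₗ[K] V} (hs : s ^ p = 1) {R : Finset V}
    (hspan : Submodule.span K (zpowOrbit s R) = movedSpace p s) [FiniteDimensional K V] :
    Module.finrank K (movedSpace p s) ≤ (p - 1) * R.card := by
  have h := (Submodule.finrank_mono (movedSpace_le_span_range hs hspan)).trans
    (finrank_range_le_card (R := K) _)
  rwa [Fintype.card_prod, Fintype.card_fin, Fintype.card_coe, mul_comm] at h

/-- A spanning family with no more members than the dimension is a basis; this is where the size
condition on a frame pays off. -/
theorem linearIndependent_frame [FiniteDimensional K V] {s : V ≃ₗ[K] V} (hs : s ^ p = 1)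
    {R : Finset V} (hspan : Submodule.span K (zpowOrbit s R) = movedSpace p s)
    (hcard : (p - 1) * R.card ≤ Module.finrank K (movedSpace p s)) :
    LinearIndependent K fun x : R × Fin (p - 1) => (s ^ (x.2 : ℕ)) x.1.1 := by
  rw [linearIndependent_iff_card_le_finrank_span, Fintype.card_prod, Fintype.card_fin,
    Fintype.card_coe, mul_comm]
  exact hcard.trans (Submodule.finrank_mono (movedSpace_le_span_range hs hspan))

theorem apply_eq_of_zpow {s a : V ≃ₗ[K] V} (hsa : Commute s a) {v : V} {k l : ℤ}
    (ha : a v = (s ^ k) v) : a ((s ^ l) v) = (s ^ k) ((s ^ l) v) := by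
  rw [← LinearEquiv.mul_apply, ← (hsa.zpow_left l).eq, LinearEquiv.mul_apply, ha,
    ← LinearEquiv.mul_apply, ((Commute.refl s).zpow_zpow l k).eq]
  rfl

/-- The automorphisms that act on each `s`-orbit of a frame as a power of `s`. -/
def diagonalSubgroup (s : V ≃ₗ[K] V) (R : Finset V) : Subgroup (V ≃ₗ[K] V) where
  carrier := {a | Commute s a ∧ (∀ v ∈ R, ∃ k : ℤ, a v = (s ^ k) v) ∧ ∀ w ∈ fixedSpace s, a w = w}
  mul_mem' := by
    rintro a b ⟨ha, haR, haf⟩ ⟨hb, hbR, hbf⟩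
    refine ⟨ha.mul_right hb, fun v hv => ?_, fun w hw => ?_⟩
    · obtain ⟨k, hk⟩ := haR v hv
      obtain ⟨l, hl⟩ := hbR v hv
      refine ⟨l + k, ?_⟩
      rw [LinearEquiv.mul_apply, hl, ← LinearEquiv.mul_apply, ← (ha.zpow_left l).eq,
        LinearEquiv.mul_apply, hk, zpow_add]
      rfl
    · rw [LinearEquiv.mul_apply, hbf w hw, haf w hw]
  one_mem' := ⟨Commute.one_right s, fun _ _ => ⟨0, rfl⟩, fun _ _ => rfl⟩
  inv_mem' := by
    rintro a ⟨ha, haR, haf⟩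
    refine ⟨ha.inv_right, fun v hv => ?_, fun w hw => ?_⟩
    · obtain ⟨k, hk⟩ := haR v hv
      refine ⟨-k, ?_⟩
      change a.symm v = _
      rw [LinearEquiv.symm_apply_eq, ← LinearEquiv.mul_apply, ← (ha.zpow_left _).eq,
        LinearEquiv.mul_apply, hk, ← LinearEquiv.mul_apply, ← zpow_add, neg_add_cancel]
      rfl
    · change a.symm w = w
      rw [LinearEquiv.symm_apply_eq, haf w hw]

/-- Conjugation by g only permutes the exponents: if g⁻¹ sends v into the s-orbit of w and a acts
there as s ^ l, then g * a * g⁻¹ acts on v as s ^ l, since g commutes with s. -/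
theorem le_normalizer_diagonalSubgroup {s : V ≃ₗ[K] V} {R : Finset V} {G : Subgroup (V ≃ₗ[K] V)}
    (hsG : ∀ g ∈ G, Commute s g) (hfix : ∀ v ∈ fixedSpace s, ∀ g ∈ G, g v = v)
    (perm : ∀ g ∈ G, ∀ v ∈ R, ∃ w ∈ R, ∃ k : ℤ, g v = (s ^ k) w) :
    G ≤ Subgroup.normalizer (diagonalSubgroup s R : Set (V ≃ₗ[K] V)) := by
  rw [Subgroup.le_normalizer_iff]
  intro g hg a ha
  have hginv : ∀ x, g (g⁻¹ x) = x := fun x => LinearEquiv.apply_symm_apply _ _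
  refine ⟨((hsG g hg).mul_right ha.1).mul_right (hsG g hg).inv_right, fun v hv => ?_, fun w hw => ?_⟩
  · obtain ⟨w, hw, k, hk⟩ := perm g⁻¹ (G.inv_mem hg) v hv
    obtain ⟨l, hl⟩ := ha.2.1 w hw
    refine ⟨l, ?_⟩
    rw [LinearEquiv.mul_apply, LinearEquiv.mul_apply, hk, apply_eq_of_zpow ha.1 hl, ← hk,
      ← LinearEquiv.mul_apply, ← ((hsG g hg).zpow_left l).eq, LinearEquiv.mul_apply, hginv]
  · rw [LinearEquiv.mul_apply, LinearEquiv.mul_apply, hfix w hw _ (G.inv_mem hg), ha.2.2 w hw,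
      hfix w hw g hg]

variable [CharZero K]

/-- Prescribed powers of `s` on the orbits of a frame define an automorphism. -/
theorem exists_automorphism_of_frame [FiniteDimensional K V] {s : V ≃ₗ[K] V} (hs : s ^ p = 1)
    {R : Finset V} (hspan : Submodule.span K (zpowOrbit s R) = movedSpace p s)
    (hcard : (p - 1) * R.card ≤ Module.finrank K (movedSpace p s)) (f : R → ℕ) :
    ∃ a : V ≃ₗ[K] V, Commute s a ∧ (∀ v : R, a v.1 = (s ^ f v) v.1) ∧
      ∀ w ∈ fixedSpace s, a w = w := by
  classical
  have hRU := mem_movedSpace_of_span_eq hspan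
  have hlast : ∀ v : R, (s ^ (p - 1)) v.1 = - ∑ i ∈ Finset.range (p - 1), (s ^ i) v.1 :=
    fun v => frame_pow_pred_apply (hRU v 0)
  let b : R × Fin (p - 1) → V := fun x => (s ^ (x.2 : ℕ)) x.1.1
  have hli : LinearIndependent K b := linearIndependent_frame hs hspan hcard
  -- Prescribe the map on the basis of the moved space and extend it arbitrarily to V; `T` below
  -- discards the arbitrary part.
  obtain ⟨T₁, hT₁⟩ := LinearMap.exists_extend
    (Finsupp.linearCombination K (fun x => (s ^ f x.1) (b x)) ∘ₗ hli.repr)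
  have hT₁b : ∀ x, T₁ (b x) = (s ^ f x.1) (b x) := by
    intro x
    have h1 := LinearMap.congr_fun hT₁ ⟨b x, Submodule.subset_span ⟨x, rfl⟩⟩
    have h2 := hli.repr_eq_single x ⟨b x, Submodule.subset_span ⟨x, rfl⟩⟩ rfl
    rw [LinearMap.comp_apply, LinearMap.comp_apply] at h1
    change T₁ (b x) = Finsupp.linearCombination K _ (hli.repr _) at h1
    rw [h2, Finsupp.linearCombination_single, one_smul] at h1
    exact h1
  have hT₁R : ∀ (v : R) (k : ℤ), T₁ ((s ^ k) v.1) = (s ^ f v) ((s ^ k) v.1) := by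
    intro v k
    obtain ⟨i, hi, hk⟩ := exists_pow_eq_zpow hs k
    rw [hk]
    have hlow : ∀ i < p - 1, T₁ ((s ^ i) v.1) = (s ^ f v) ((s ^ i) v.1) := fun i hi =>
      hT₁b (v, ⟨i, hi⟩)
    rcases Nat.lt_or_ge i (p - 1) with h | h
    · exact hlow i h
    · obtain rfl : i = p - 1 := by omega
      -- The remaining translate is a combination of basis vectors on all of which T₁ agrees with
      -- the same linear map s ^ f v.
      rw [hlast v, map_neg, map_neg, map_sum, map_sum,
        Finset.sum_congr rfl fun i hi => hlow i (Finset.mem_range.mp hi)]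
  let T : V →ₗ[K] V := averageMap p s + T₁ ∘ₗ (LinearMap.id - averageMap p s)
  have hT : ∀ v, T v = averageMap p s v + T₁ (v - averageMap p s v) := fun _ => rfl
  have hTR : ∀ (v : R) (k : ℤ), T ((s ^ k) v.1) = (s ^ f v) ((s ^ k) v.1) := by
    intro v k
    rw [hT, averageMap_eq_zero (hRU v k), sub_zero, zero_add, hT₁R]
  have hTfix : ∀ w ∈ fixedSpace s, T w = w := by
    intro w hw
    rw [hT, averageMap_eq_self hw, sub_self, map_zero, add_zero]
  have hTpow : ∀ n : ℕ, (∀ (v : R) (k : ℤ), (T ^ n) ((s ^ k) v.1) = (s ^ (n * f v)) ((s ^ k) v.1)) ∧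
      ∀ w ∈ fixedSpace s, (T ^ n) w = w := by
    intro n
    induction n with
    | zero => exact ⟨fun v k => by simp, fun w _ => by simp⟩
    | succ n ih =>
      refine ⟨fun v k => ?_, fun w hw => ?_⟩
      · rw [pow_succ, Module.End.mul_apply, hTR, ← LinearEquiv.mul_apply, ← zpow_natCast,
          ← zpow_add, ih.1, add_one_mul, pow_add, zpow_add, zpow_natCast]
        rfl
      · rw [pow_succ, Module.End.mul_apply, hTfix w hw, ih.2 w hw]
  have hTp : T ^ p = 1 := by
    refine linearMap_ext_of_frame hs hspan (hTpow p).2 fun v hv k => ?_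
    rw [(hTpow p).1 ⟨v, hv⟩ k, pow_mul, hs, one_pow]
    rfl
  have hpp : p - 1 + 1 = p := Nat.sub_add_cancel hp.1.pos
  let a : V ≃ₗ[K] V := LinearEquiv.ofLinearMap T (T ^ (p - 1))
    (by rw [← Module.End.mul_eq_comp, ← pow_succ', hpp, hTp]; rfl)
    (by rw [← Module.End.mul_eq_comp, ← pow_succ, hpp, hTp]; rfl)
  refine ⟨a, ?_, fun v => hTR v 0, hTfix⟩
  apply LinearEquiv.toLinearMap_injective
  refine linearMap_ext_of_frame hs hspan ?_ ?_
  · intro w hw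
    change s (T w) = T (s w)
    rw [hTfix w hw, mem_fixedSpace.mp hw, hTfix w hw]
  · intro v hv k
    change s (T ((s ^ k) v)) = T (s ((s ^ k) v))
    have h1 : s ((s ^ k) v) = (s ^ (1 + k)) v := by rw [zpow_add, zpow_one]; rfl
    rw [h1, hTR ⟨v, hv⟩, hTR ⟨v, hv⟩, ← h1, ← LinearEquiv.mul_apply, ← LinearEquiv.mul_apply,
      ((Commute.refl s).pow_right _).eq]
    rfl

theorem diagonalSubgroup_ext {s : V ≃ₗ[K] V} (hs : s ^ p = 1) {R : Finset V}
    (hspan : Submodule.span K (zpowOrbit s R) = movedSpace p s) {a b : V ≃ₗ[K] V}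
    (ha : a ∈ diagonalSubgroup s R) (hb : b ∈ diagonalSubgroup s R) (hab : ∀ v ∈ R, a v = b v) :
    a = b := by
  apply LinearEquiv.toLinearMap_injective
  refine linearMap_ext_of_frame hs hspan (fun w hw => (ha.2.2 w hw).trans (hb.2.2 w hw).symm) ?_
  intro v hv k
  change (a * s ^ k) v = (b * s ^ k) v
  rw [← (ha.1.zpow_left k).eq, ← (hb.1.zpow_left k).eq, LinearEquiv.mul_apply, hab v hv]
  rfl

theorem diagonalSubgroup_mul_comm {s : V ≃ₗ[K] V} (hs : s ^ p = 1) {R : Finset V}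
    (hspan : Submodule.span K (zpowOrbit s R) = movedSpace p s) {a b : V ≃ₗ[K] V}
    (ha : a ∈ diagonalSubgroup s R) (hb : b ∈ diagonalSubgroup s R) : a * b = b * a := by
  refine diagonalSubgroup_ext hs hspan (Subgroup.mul_mem _ ha hb) (Subgroup.mul_mem _ hb ha) ?_
  intro v hv
  obtain ⟨k, hk⟩ := ha.2.1 v hv
  obtain ⟨l, hl⟩ := hb.2.1 v hv
  rw [LinearEquiv.mul_apply, LinearEquiv.mul_apply, hk, hl, apply_eq_of_zpow ha.1 hk,
    apply_eq_of_zpow hb.1 hl, ← LinearEquiv.mul_apply, ((Commute.refl s).zpow_zpow k l).eq]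
  rfl

theorem diagonalSubgroup_pow_eq_one {s : V ≃ₗ[K] V} (hs : s ^ p = 1) {R : Finset V}
    (hspan : Submodule.span K (zpowOrbit s R) = movedSpace p s) {a : V ≃ₗ[K] V}
    (ha : a ∈ diagonalSubgroup s R) : a ^ p = 1 := by
  refine diagonalSubgroup_ext hs hspan (Subgroup.pow_mem _ ha p) (Subgroup.one_mem _) ?_
  intro v hv
  obtain ⟨k, hk⟩ := ha.2.1 v hv
  have h1 : ∀ n : ℕ, (a ^ n) v = (s ^ (k * n)) v := by
    intro n
    induction n with
    | zero => simp
    | succ n ih =>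
      rw [pow_succ', LinearEquiv.mul_apply, ih, apply_eq_of_zpow ha.1 hk, Nat.cast_succ, mul_add_one,
        add_comm, zpow_add]
      rfl
  rw [h1, mul_comm, zpow_mul, zpow_natCast, hs, one_zpow]

theorem finite_diagonalSubgroup {s : V ≃ₗ[K] V} (hs : s ^ p = 1) {R : Finset V}
    (hspan : Submodule.span K (zpowOrbit s R) = movedSpace p s) : Finite (diagonalSubgroup s R) := by
  have hex : ∀ (a : diagonalSubgroup s R) (v : R), ∃ i : Fin p, a.1 v.1 = (s ^ (i : ℕ)) v.1 := by
    intro a v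
    obtain ⟨k, hk⟩ := a.2.2.1 v.1 v.2
    obtain ⟨i, hi, hki⟩ := exists_pow_eq_zpow hs k
    exact ⟨⟨i, hi⟩, by rw [hk, hki]⟩
  choose κ hκ using hex
  refine Finite.of_injective κ fun a b hab => Subtype.ext ?_
  refine diagonalSubgroup_ext hs hspan a.2 b.2 fun v hv => ?_
  have h1 := hκ a ⟨v, hv⟩
  have h2 := hκ b ⟨v, hv⟩
  rw [hab] at h1
  exact h1.trans h2.symm

/-- Exponents modulo p can be prescribed independently on the members of R. Distinct choices differ:
if s ^ m fixed v with p ∤ m, the vanishing sum of the powers of s ^ m would give p • v = 0. -/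
theorem pow_card_le_card_diagonalSubgroup [FiniteDimensional K V] {s : V ≃ₗ[K] V} (hs : s ^ p = 1)
    {R : Finset V} (hspan : Submodule.span K (zpowOrbit s R) = movedSpace p s)
    (hcard : (p - 1) * R.card ≤ Module.finrank K (movedSpace p s)) :
    p ^ R.card ≤ Nat.card (diagonalSubgroup s R) := by
  have := finite_diagonalSubgroup hs hspan
  have hex := fun f : R → Fin p => exists_automorphism_of_frame hs hspan hcard fun v => (f v : ℕ)
  choose a hsa haR hafix using hex
  have hR0 : ∀ v : R, v.1 ≠ 0 := fun v => by
    have h := (linearIndependent_frame hs hspan hcard).ne_zero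
      (v, ⟨0, Nat.sub_pos_of_lt hp.1.one_lt⟩)
    rwa [pow_zero] at h
  have hcardf : Nat.card (R → Fin p) = p ^ R.card := by
    rw [Nat.card_fun, Nat.card_fin, Nat.card_eq_fintype_card, Fintype.card_coe]
  rw [← hcardf]
  refine Nat.card_le_card_of_injective (fun f => (⟨a f, hsa f, fun v hv =>
    ⟨(f ⟨v, hv⟩ : ℕ), by rw [zpow_natCast]; exact haR f ⟨v, hv⟩⟩, hafix f⟩ :
      diagonalSubgroup s R)) ?_
  intro f g hfg
  have hfg' : a f = a g := congrArg Subtype.val hfg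
  funext v
  have h1 : (s ^ (f v : ℕ)) v.1 = (s ^ (g v : ℕ)) v.1 := by rw [← haR f, ← haR g, hfg']
  have h2 : (s ^ ((f v : ℤ) - (g v : ℤ))) v.1 = v.1 := by
    rw [sub_eq_neg_add, zpow_add, LinearEquiv.mul_apply, zpow_natCast, h1, ← zpow_natCast,
      ← LinearEquiv.mul_apply, ← zpow_add, neg_add_cancel]
    rfl
  by_contra hne
  have hnd : ¬ (p : ℤ) ∣ (f v : ℤ) - (g v : ℤ) := by
    intro hdvd
    have h3 := (f v).2
    have h4 := (g v).2
    have h5 := Int.eq_zero_of_abs_lt_dvd hdvd (by rw [abs_lt]; omega)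
    exact hne (Fin.ext (by omega))
  have h6 := sum_zpow_eq_zero hs (movedSpace_invariant (Commute.refl s))
    (fun u hu => mem_movedSpace.mp hu) hnd (mem_movedSpace_of_span_eq hspan v 0)
  have h7 : ∀ j : ℕ, ((s ^ ((f v : ℤ) - (g v : ℤ))) ^ j) v.1 = v.1 := by
    intro j
    induction j with
    | zero => rfl
    | succ j ih => rw [pow_succ, LinearEquiv.mul_apply, h2, ih]
  rw [zpow_zero, LinearEquiv.coe_one, id_eq, Finset.sum_congr rfl fun j _ => h7 j, Finset.sum_const,
    Finset.card_range, ← Nat.cast_smul_eq_nsmul K, smul_eq_zero] at h6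
  exact h6.elim (by exact_mod_cast hp.1.ne_zero) (hR0 v)

/-- A maximal finite `p`-group of automorphisms of `V` contains an elementary abelian group of rank
`⌊dim V / (p - 1)⌋`. -/
theorem exists_elementary_abelian_le_of_maximal [FiniteDimensional K V] (hodd : p ≠ 2)
    (hirr : ∀ n : ℕ, Irreducible (Polynomial.cyclotomic (p ^ (n + 1)) K))
    {G : Subgroup (V ≃ₗ[K] V)}
    (hG : Maximal (fun H : Subgroup (V ≃ₗ[K] V) => Finite H ∧ IsPGroup p H) G) :
    ∃ A ≤ G, (∀ a ∈ A, ∀ b ∈ A, a * b = b * a) ∧ (∀ a ∈ A, a ^ p = 1) ∧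
      p ^ (Module.finrank K V / (p - 1)) ≤ Nat.card A := by
  have hGf := hG.prop.1
  have hGp := hG.prop.2
  have hirr0 : Irreducible (Polynomial.cyclotomic p K) := by simpa using hirr 0
  obtain ⟨s, hs, hsG, hfix, hlt⟩ := exists_commuting_automorphism hirr0 G hGp
  -- Adjoining s to G still gives a finite `p`-group, so maximality absorbs s; the diagonal subgroup
  -- is absorbed below in the same way.
  have hsmem : s ∈ G := hG.le_of_ge (finite_isPGroup_sup_zpowers hGp hs hsG) le_sup_left
    ((le_sup_right : Subgroup.zpowers s ≤ _) (Subgroup.mem_zpowers s))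
  obtain ⟨R, hR⟩ := exists_monomialFrame hodd hirr hs G hGp hsmem hsG (movedSpace p s)
    (fun g hg => movedSpace_invariant (hsG g hg)) (fun u hu => mem_movedSpace.mp hu)
  have hspan := hR.span_eq
  have hAf := finite_diagonalSubgroup hs hspan
  have hAp : IsPGroup p (diagonalSubgroup s R) := by
    rw [isPGroup_iff_pow_pow_eq_one]
    refine fun a => ⟨1, Subtype.ext ?_⟩
    rw [pow_one]
    exact diagonalSubgroup_pow_eq_one hs hspan a.2
  have hnorm := le_normalizer_diagonalSubgroup hsG hfix hR.perm
  have hle : diagonalSubgroup s R ≤ G := le_sup_right.trans (hG.le_of_ge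
    ⟨Subgroup.finite_sup_of_le_normalizer hnorm, hGp.to_sup_of_normal_right' hAp hnorm⟩ le_sup_left)
  refine ⟨diagonalSubgroup s R, hle, fun a ha b hb => diagonalSubgroup_mul_comm hs hspan ha hb,
    fun a ha => diagonalSubgroup_pow_eq_one hs hspan ha,
    le_trans (Nat.pow_le_pow_right hp.1.pos ?_) (pow_card_le_card_diagonalSubgroup hs hspan hR.card_le)⟩
  have h1 := finrank_fixedSpace_add_finrank_movedSpace hs
  have h2 := finrank_movedSpace_le hs hspan
  -- The inequality reduces to dim V < (p - 1)(|R| + 1): the moved space has dimension at most (p -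
  -- 1)|R| and the fixed space less than p - 1.
  rw [← Nat.lt_succ_iff, Nat.div_lt_iff_lt_mul (Nat.sub_pos_of_lt hp.1.one_lt), Nat.succ_mul,
    mul_comm]
  omega

end Lower

/-! ### Generator counts and the rank formula -/

/-- A finite abelian group of exponent `p` generated by `S` has at most `p ^ |S|` elements. -/
theorem card_le_pow_card_of_closure_eq_top {p : ℕ} [hp : Fact p.Prime] {A : Type*} [Group A]
    [Finite A] (hcomm : ∀ a b : A, a * b = b * a) (hpow : ∀ a : A, a ^ p = 1) {S : Finset A}
    (hS : Subgroup.closure (S : Set A) = ⊤) : Nat.card A ≤ p ^ S.card := by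
  let _ : CommGroup A := { ‹Group A› with mul_comm := hcomm }
  let _ : Module (ZMod p) (Additive A) := AddCommGroup.zmodModule (n := p) hpow
  let S' : Finset (Additive A) := S.map Additive.ofMul.toEmbedding
  let W : Submodule (ZMod p) (Additive A) := Submodule.span (ZMod p) (S' : Set (Additive A))
  have hspan : W = ⊤ := by
    have hle : Subgroup.closure (S : Set A) ≤ AddSubgroup.toSubgroup' W.toAddSubgroup := by
      rw [Subgroup.closure_le]
      intro a ha
      change Additive.ofMul a ∈ W
      exact Submodule.subset_span (Finset.mem_coe.mpr (Finset.mem_map_of_mem _ ha))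
    rw [hS] at hle
    rw [eq_top_iff]
    intro x _
    exact hle (Subgroup.mem_top x.toMul)
  have hfin : Module.finrank (ZMod p) (Additive A) ≤ S.card := by
    have h := finrank_span_finset_le_card (R := ZMod p) S'
    change Module.finrank (ZMod p) W ≤ _ at h
    rw [hspan, finrank_top, Finset.card_map] at h
    exact h
  calc Nat.card A = Nat.card (Additive A) := rfl
    _ = p ^ Module.finrank (ZMod p) (Additive A) := by
      rw [Module.natCard_eq_pow_finrank (K := ZMod p), Nat.card_zmod]
    _ ≤ p ^ S.card := Nat.pow_le_pow_right hp.1.pos hfin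

theorem topGenNumber_le_of_closure_eq_top {H : Type*} [Group H] [TopologicalSpace H] {S : Finset H}
    (hS : Subgroup.closure (S : Set H) = ⊤) : topGenNumber H ≤ S.card := by
  refine (iInf₂_le (S : Set H) ?_).trans ?_
  · rw [hS]; exact dense_univ
  · rw [Set.encard_coe_eq_coe_finsetCard]

theorem le_topGenNumber_of_discrete {H : Type*} [Group H] [TopologicalSpace H] [DiscreteTopology H]
    [Finite H] {m : ℕ} (h : ∀ S : Finset H, Subgroup.closure (S : Set H) = ⊤ → m ≤ S.card) :
    (m : ℕ∞) ≤ topGenNumber H := by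
  refine le_iInf₂ fun S hS => ?_
  obtain ⟨T, rfl⟩ := (Set.toFinite S).exists_finset_coe
  rw [Set.encard_coe_eq_coe_finsetCard]
  have h1 : Subgroup.closure (T : Set H) = ⊤ := by
    rw [dense_discrete] at hS
    exact SetLike.coe_injective hS
  exact_mod_cast h T h1

theorem IsMaximalFinitePSubgroup.map_equiv {p : ℕ} {Γ Γ' : Type*} [Group Γ] [Group Γ'] (e : Γ ≃* Γ')
    {G : Subgroup Γ} (hG : IsMaximalFinitePSubgroup p G) :
    IsMaximalFinitePSubgroup p (G.map e.toMonoidHom) := by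
  obtain ⟨⟨hf, hp⟩, hmax⟩ := hG
  refine ⟨⟨Finite.of_equiv G (G.equivMapOfInjective _ e.injective).toEquiv, hp.map _⟩, ?_⟩
  rintro H ⟨hHf, hHp⟩ hle
  have h1 : H.map e.symm.toMonoidHom ≤ G := by
    refine hmax ⟨Finite.of_equiv H (H.equivMapOfInjective _ e.symm.injective).toEquiv, hHp.map _⟩ ?_
    intro g hg
    exact ⟨e g, hle ⟨g, hg, rfl⟩, e.symm_apply_apply g⟩
  intro h hh
  exact ⟨e.symm h, h1 ⟨h, hh, rfl⟩, e.apply_symm_apply h⟩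

theorem mainTheorem9 (p : ℕ) [Fact p.Prime] (hp : Odd p) (d : ℕ) (hd : 1 ≤ d)
    (G : Subgroup (Matrix.GeneralLinearGroup (Fin d) ℚ_[p]))
    (hG : IsMaximalFinitePSubgroup p G) :
    profiniteRank G = ((d / (p - 1) : ℕ) : ℕ∞) := by
  have hodd : p ≠ 2 := by
    rintro rfl
    exact absurd hp (by decide)
  have hpos : 0 < p - 1 := Nat.sub_pos_of_lt (Fact.out : p.Prime).one_lt
  have hirr := Polynomial.irreducible_cyclotomic_prime_pow_padic p
  have hGf : Finite G := hG.prop.1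
  have hGp : IsPGroup p G := hG.prop.2
  have hfr : Module.finrank ℚ_[p] (Fin d → ℚ_[p]) = d := Module.finrank_fin_fun _
  let e : Matrix.GeneralLinearGroup (Fin d) ℚ_[p] ≃* ((Fin d → ℚ_[p]) ≃ₗ[ℚ_[p]] (Fin d → ℚ_[p])) :=
    Matrix.GeneralLinearGroup.toLin.trans (LinearMap.GeneralLinearGroup.generalLinearEquiv _ _)
  apply le_antisymm
  · refine iSup₂_le fun H _ => ?_
    obtain ⟨S, hS, hcard⟩ := exists_finset_closure_eq_top_of_automorphisms hodd hirr
      ((e.toMonoidHom.comp G.subtype).comp H.subtype)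
      ((e.injective.comp Subtype.val_injective).comp Subtype.val_injective) (hGp.to_subgroup H)
    refine (topGenNumber_le_of_closure_eq_top hS).trans ?_
    rw [hfr] at hcard
    exact_mod_cast (Nat.le_div_iff_mul_le hpos).mpr (by rwa [mul_comm])
  · obtain ⟨A, hAG, hcomm, hpow, hcard⟩ :=
      exists_elementary_abelian_le_of_maximal hodd hirr (hG.map_equiv e)
    rw [hfr] at hcard
    let B : Subgroup G := (A.comap e.toMonoidHom).subgroupOf G
    have hBA : Nat.card B = Nat.card A := by
      refine Nat.card_eq_of_bijective (fun b : B => (⟨e b.1.1, b.2⟩ : A)) ⟨?_, ?_⟩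
      · intro a b hab
        exact Subtype.ext (Subtype.ext (e.injective (congrArg Subtype.val hab)))
      · rintro ⟨a, ha⟩
        obtain ⟨g, hg, rfl⟩ := hAG ha
        exact ⟨⟨⟨g, hg⟩, ha⟩, rfl⟩
    have hBcomm : ∀ a b : B, a * b = b * a := fun a b => Subtype.ext (Subtype.ext (e.injective (by
      have := hcomm _ a.2 _ b.2
      simpa using this)))
    have hBpow : ∀ a : B, a ^ p = 1 := fun a => Subtype.ext (Subtype.ext (e.injective (by
      have := hpow _ a.2
      simpa using this)))
    -- The copy B of the elementary abelian group is finite, hence closed, so it enters the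
    -- supremum; its order bounds its number of generators from below.
    refine le_trans ?_ (le_iSup₂_of_le B (Set.toFinite _).isClosed le_rfl)
    refine le_topGenNumber_of_discrete fun S hS => ?_
    have h1 := card_le_pow_card_of_closure_eq_top hBcomm hBpow hS
    rw [hBA] at h1
    exact (Nat.pow_le_pow_iff_right (Fact.out : p.Prime).one_lt).mp (hcard.trans h1)
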